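/- An instance consists of $\ell$ graphs $G_i=(V,E_i)$, $i\in\{1,\dots,\ell\}$ (the layers), on a common vertex set $V$ with $n=|V|$, and two integers $k,d\ge 0$. A cluster graph is a graph in which every connected component is a clique. A $k$-bounded clustering is a sequence $(M_i)_{1\le i\le\ell}$ of sets $M_i\subseteq\binom V2$ with $|M_i|\le k$ such that every $G_i'=(V,E_i\oplus M_i)$ is a cluster graph, where $\oplus$ is the symmetric difference. Multi-Layer Cluster Editing (MLCE) asks whether there are a $k$-bounded clustering and a set $D\subseteq V$ with $|D|\le d$ such that $G_i'[V\setminus D]=G_j'[V\setminus D]$ for all $i,j\in\{1,\dots,\ell\}$. Temporal Cluster Editing (TCE) asks whether there are a $k$-bounded clustering and sets $D_1,\dots,D_{\ell-1}\subseteq V$ with $|D_i|\le d$ such that $G_i'[V\setminus D_i]=G_{i+1}'[V\setminus D_i]$ for all $i\in\{1,\dots,\ell-1\}$. A kernel of size $O(f(k,d,\ell))$ for such a problem is an algorithm that transforms every instance into an instance of the same problem, with parameters $k',d',\ell'$, that has the same answer, and whose length in bits (numbers in binary, graphs as adjacency matrices) plus $k'+d'+\ell'$ is $O(f(k,d,\ell))$.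 Running times are measured on a word RAM with words of $O(\log(n+\ell+k+d+2))$ bits, and $O(g)$ means at most $C\cdot(g+1)$ for an absolute constant $C$. Theorem. MLCE has a kernel of size $O(\ell^3(k+d)^4)$, and TCE has a kernel of size $O(\ell^3(k+d\ell)^4)$. Both kernels can be computed in $O(\ell\cdot n^3)$ time. -/

import Mathlib

/-! ### Cluster editing of multi-layer and temporal graphs -/

namespace ClusterEditing

/-- A cluster graph: every connected component is a clique. -/
def IsClusterGraph {V : Type*} (G : SimpleGraph V) : Prop :=
  ∀ c : G.ConnectedComponent, G.IsClique c.supp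

/-- The graph `(V, E ⊕ M)`, where `⊕` is the symmetric difference. -/
def edit {V : Type*} (G : SimpleGraph V) (M : Finset (Sym2 V)) : SimpleGraph V :=
  SimpleGraph.fromEdgeSet (symmDiff G.edgeSet (M : Set (Sym2 V)))

/-- `M` is a set of unordered pairs of distinct vertices and `(V, E ⊕ M)` is a cluster graph. -/
def IsClusterEditingSet {V : Type*} (G : SimpleGraph V) (M : Finset (Sym2 V)) : Prop :=
  (∀ e ∈ M, ¬ e.IsDiag) ∧ IsClusterGraph (edit G M)

/-- A clustering of the layers `G`: one cluster editing set for every layer. -/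
def IsClustering {V : Type*} {ℓ : ℕ} (G : Fin ℓ → SimpleGraph V)
    (M : Fin ℓ → Finset (Sym2 V)) : Prop :=
  ∀ i, IsClusterEditingSet (G i) (M i)

/-- Every layer is edited in at most `k` pairs. -/
def IsBounded {V : Type*} {ℓ : ℕ} (k : ℕ) (M : Fin ℓ → Finset (Sym2 V)) : Prop :=
  ∀ i, (M i).card ≤ k

/-- `G[V ∖ D] = H[V ∖ D]`. -/
def AgreeOutside {V : Type*} (D : Finset V) (G H : SimpleGraph V) : Prop :=
  G.induce ((D : Set V)ᶜ) = H.induce ((D : Set V)ᶜ)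

/-- One set `D` of at most `d` marked vertices such that outside `D` all edited layers coincide. -/
def TotallyConsistent {V : Type*} {ℓ : ℕ} (d : ℕ) (G : Fin ℓ → SimpleGraph V)
    (M : Fin ℓ → Finset (Sym2 V)) : Prop :=
  ∃ D : Finset V, D.card ≤ d ∧
    ∀ i j, AgreeOutside D (edit (G i) (M i)) (edit (G j) (M j))

/-- For each pair of consecutive layers a set of at most `d` marked vertices outside of which
the two edited layers coincide. -/
def TemporallyConsistent {V : Type*} {ℓ : ℕ} (d : ℕ) (G : Fin ℓ → SimpleGraph V)
    (M : Fin ℓ → Finset (Sym2 V)) : Prop :=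
  ∃ D : Fin (ℓ - 1) → Finset V, (∀ i, (D i).card ≤ d) ∧
    ∀ i : Fin (ℓ - 1),
      AgreeOutside (D i)
        (edit (G ⟨i, by omega⟩) (M ⟨i, by omega⟩))
        (edit (G ⟨i + 1, by omega⟩) (M ⟨i + 1, by omega⟩))

/-- An instance of either problem: `ℓ` graphs (the layers, in their order) on the common
vertex set `{0, …, n - 1}`, and the two budgets `k` and `d`. -/
structure Instance where
  /-- number of vertices -/
  n : ℕ
  /-- number of layers -/
  ℓ : ℕ
  /-- number of edge modifications allowed per layer -/
  k : ℕ
  /-- number of vertices that may be marked -/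
  d : ℕ
  /-- the layers -/
  layer : Fin ℓ → SimpleGraph (Fin n)

/-- Multi-Layer Cluster Editing: is there a totally `d`-consistent `k`-bounded clustering? -/
def MLCE (I : Instance) : Prop :=
  ∃ M : Fin I.ℓ → Finset (Sym2 (Fin I.n)),
    IsClustering I.layer M ∧ IsBounded I.k M ∧ TotallyConsistent I.d I.layer M

/-- Temporal Cluster Editing: is there a temporally `d`-consistent `k`-bounded clustering? -/
def TCE (I : Instance) : Prop :=
  ∃ M : Fin I.ℓ → Finset (Sym2 (Fin I.n)),
    IsClustering I.layer M ∧ IsBounded I.k M ∧ TemporallyConsistent I.d I.layer M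

/-- Number of bits of the standard description of an instance: the numbers `n`, `ℓ`, `k`, `d` in
binary (every bit doubled, so that the numbers can be told apart, plus a two-bit end mark each),
followed by the `ℓ` adjacency matrices. -/
def Instance.bitLength (I : Instance) : ℕ :=
  (2 * I.n.size + 2) + (2 * I.ℓ.size + 2) + (2 * I.k.size + 2) + (2 * I.d.size + 2)
    + I.ℓ * I.n ^ 2

end ClusterEditing

/-! ### A word random access machine with a step count -/

namespace WordRAM

/-- Memory: registers and arrays of natural numbers. A program names only finitely many of them. -/
structure State where
  /-- contents of the registers -/
  reg : ℕ → ℕ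
  /-- `mem a x` is the entry of array `a` at address `x` -/
  mem : ℕ → ℕ → ℕ

/-- Write `v` into register `r`. -/
def State.setReg (s : State) (r v : ℕ) : State :=
  { s with reg := Function.update s.reg r v }

/-- Write `v` into array `a` at address `x`. -/
def State.setMem (s : State) (a x v : ℕ) : State :=
  { s with mem := Function.update s.mem a (Function.update (s.mem a) x v) }

/-- Expressions. -/
inductive Expr where
  | const (c : ℕ)
  | reg (r : ℕ)
  | load (a : ℕ) (x : Expr)
  | add (e f : Expr)
  | sub (e f : Expr)
  | mul (e f : Expr)
  | lt (e f : Expr)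
  | eq (e f : Expr)

/-- Value of an expression; subtraction is truncated at `0`, comparisons have the value
`1` (true) or `0` (false). -/
def Expr.eval (s : State) : Expr → ℕ
  | .const c => c
  | .reg r => s.reg r
  | .load a x => s.mem a (x.eval s)
  | .add e f => e.eval s + f.eval s
  | .sub e f => e.eval s - f.eval s
  | .mul e f => e.eval s * f.eval s
  | .lt e f => if e.eval s < f.eval s then 1 else 0
  | .eq e f => if e.eval s = f.eval s then 1 else 0

/-- Every value that occurs in the evaluation (addresses included) is smaller than `B`, that is,
fits into a machine word. -/
def Expr.Fits (B : ℕ) (s : State) : Expr → Prop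
  | .const c => c < B
  | .reg r => s.reg r < B
  | .load a x => x.Fits B s ∧ s.mem a (x.eval s) < B
  | .add e f => e.Fits B s ∧ f.Fits B s ∧ e.eval s + f.eval s < B
  | .sub e f => e.Fits B s ∧ f.Fits B s
  | .mul e f => e.Fits B s ∧ f.Fits B s ∧ e.eval s * f.eval s < B
  | .lt e f => e.Fits B s ∧ f.Fits B s ∧ 1 < B
  | .eq e f => e.Fits B s ∧ f.Fits B s ∧ 1 < B

/-- Steps needed to evaluate an expression: one for each constant, register, memory access,
arithmetic operation and comparison. -/
def Expr.cost : Expr → ℕ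
  | .const _ => 1
  | .reg _ => 1
  | .load _ x => x.cost + 1
  | .add e f => e.cost + f.cost + 1
  | .sub e f => e.cost + f.cost + 1
  | .mul e f => e.cost + f.cost + 1
  | .lt e f => e.cost + f.cost + 1
  | .eq e f => e.cost + f.cost + 1

/-- Programs. A condition holds when its value is not `0`. -/
inductive Prog where
  | skip
  | assign (r : ℕ) (e : Expr)
  | store (a : ℕ) (x e : Expr)
  | seq (p q : Prog)
  | ite (c : Expr) (p q : Prog)
  | while (c : Expr) (p : Prog)

/-- `Exec B p s s' t`: started in state `s`, the program `p` halts in state `s'` after exactly `t`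
steps, and no value that occurs during the run is `B` or larger. Execution is deterministic; a
program that would produce an overflow has no run. -/
inductive Exec (B : ℕ) : Prog → State → State → ℕ → Prop where
  | skip (s : State) : Exec B .skip s s 1
  | assign (s : State) (r : ℕ) (e : Expr) (he : e.Fits B s) :
      Exec B (.assign r e) s (s.setReg r (e.eval s)) (e.cost + 1)
  | store (s : State) (a : ℕ) (x e : Expr) (hx : x.Fits B s) (he : e.Fits B s) :
      Exec B (.store a x e) s (s.setMem a (x.eval s) (e.eval s)) (x.cost + e.cost + 1)
  | seq {p q : Prog} {s₁ s₂ s₃ : State} {t₁ t₂ : ℕ}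
      (hp : Exec B p s₁ s₂ t₁) (hq : Exec B q s₂ s₃ t₂) :
      Exec B (.seq p q) s₁ s₃ (t₁ + t₂)
  | ite_true {c : Expr} {p q : Prog} {s s' : State} {t : ℕ}
      (hf : c.Fits B s) (hc : c.eval s ≠ 0) (hp : Exec B p s s' t) :
      Exec B (.ite c p q) s s' (c.cost + 1 + t)
  | ite_false {c : Expr} {p q : Prog} {s s' : State} {t : ℕ}
      (hf : c.Fits B s) (hc : c.eval s = 0) (hq : Exec B q s s' t) :
      Exec B (.ite c p q) s s' (c.cost + 1 + t)
  | while_false {c : Expr} {p : Prog} {s : State}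
      (hf : c.Fits B s) (hc : c.eval s = 0) :
      Exec B (.while c p) s s (c.cost + 1)
  | while_true {c : Expr} {p : Prog} {s₁ s₂ s₃ : State} {t₁ t₂ : ℕ}
      (hf : c.Fits B s₁) (hc : c.eval s₁ ≠ 0) (hp : Exec B p s₁ s₂ t₁)
      (hw : Exec B (.while c p) s₂ s₃ t₂) :
      Exec B (.while c p) s₁ s₃ (c.cost + 1 + t₁ + t₂)

end WordRAM

/-! ### Kernelization -/

namespace ClusterEditing

open Classical in
/-- The state `s` represents the instance `I`: registers `0`, `1`, `2`, `3` hold `n`, `ℓ`, `k`, `d`,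
and array `0` holds the adjacency matrices of the layers, one after the other, row by row. -/
def Represents (s : WordRAM.State) (I : Instance) : Prop :=
  s.reg 0 = I.n ∧ s.reg 1 = I.ℓ ∧ s.reg 2 = I.k ∧ s.reg 3 = I.d ∧
    ∀ (i : Fin I.ℓ) (u v : Fin I.n),
      s.mem 0 ((i * I.n + u) * I.n + v) = if (I.layer i).Adj u v then 1 else 0

open Classical in
/-- The initial state on input `I`: it represents `I`, and everything else is `0`. -/
noncomputable def initState (I : Instance) : WordRAM.State where
  reg r := if r = 0 then I.n else if r = 1 then I.ℓ else if r = 2 then I.k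
    else if r = 3 then I.d else 0
  mem a x := if a = 0 ∧ ∃ (i : Fin I.ℓ) (u v : Fin I.n),
    x = (i * I.n + u) * I.n + v ∧ (I.layer i).Adj u v then 1 else 0

/-- The problem `Q`, parameterized by `k`, `d` and `ℓ`, has a kernel of size `O(size k d ℓ)` that
can be computed in time `O(time n ℓ)`: some program transforms every instance `I` into an instance
`J` with the same answer, where the bit length of `J` plus its parameter is at most
`C * (size k d ℓ + 1)` and the running time is at most `C * (time n ℓ + 1)`, on machine words of
`O(log (n + ℓ + k + d + 2))` bits. The summand `1` matters only where a bound is `0`. -/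
def HasKernel (Q : Instance → Prop) (size : (k d ℓ : ℕ) → ℕ) (time : (n ℓ : ℕ) → ℕ) : Prop :=
  ∃ (p : WordRAM.Prog) (c C : ℕ), ∀ I : Instance, ∃ (J : Instance) (s : WordRAM.State) (t : ℕ),
    WordRAM.Exec ((I.n + I.ℓ + I.k + I.d + 2) ^ c) p (initState I) s t ∧
    Represents s J ∧
    (Q J ↔ Q I) ∧
    J.bitLength + (J.k + J.d + J.ℓ) ≤ C * (size I.k I.d I.ℓ + 1) ∧
    t ≤ C * (time I.n I.ℓ + 1)

end ClusterEditing

/-! Both problems fit one scheme: marked sets `D c`, and for every label `c` a relation listing the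
pairs of layers that must agree outside `D c`. The size bound needs only that the related pairs
connect all layers.

Call two vertices twins if they have the same closed neighborhood in every layer. Among `k + d + 2`
twins, `k` edits per layer can neither separate two of them nor touch all of them, and `d` marks
cannot cover them. So a further twin can join their cluster in every layer without a new edit or
mark (`Solvable.insert_twin`). A twin class with no neighbors outside itself is the same clique
component in every layer and can stay as it is (`Solvable.univ_of_not_isIsolated`). Hence it
suffices to keep at most `k + d + 2` vertices of each remaining class (`solvable_kernelVerts_iff`).

For the size, fix a solution on the kept vertices. With `m` bounding the number of labels, at most
`2kℓ` vertices are touched by edits and at most `dm` are marked. The other vertices are twins as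
soon as they share a cluster; since their class is not isolated, each of them shares a cluster, in
some layer, with a touched or marked vertex. An unmarked touched vertex accounts for one such
cluster, a marked one for at most one per layer, and each cluster contributes at most `k + d + 2`
twins (`IsSolution.card_kernelVerts_le`). With `p = k + dm` this gives `O(ℓp²)` vertices, hence
`O(ℓ³p⁴)` matrix entries. If the kernel is larger, the answer is no and a fixed no-instance is
output.

Comparing two closed neighborhoods in all layers takes `O(ℓn)` steps, and a bounded number of
comparisons per pair of vertices suffices; this gives `O(ℓn³)`. -/

namespace ClusterEditing

/-! ### Cluster graphs, edits and agreement in terms of adjacency -/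

theorem isClusterGraph_iff {V : Type*} {G : SimpleGraph V} :
    IsClusterGraph G ↔ ∀ u v w, G.Adj u v → G.Adj v w → u ≠ w → G.Adj u w := by
  constructor
  · intro h u v w huv hvw hne
    refine h (G.connectedComponentMk u) ?_ ?_ hne
    · simp
    · rw [SimpleGraph.ConnectedComponent.mem_supp_iff, SimpleGraph.ConnectedComponent.eq]
      exact (hvw.symm.reachable).trans huv.symm.reachable
  · intro h c u hu v hv hne
    rw [SimpleGraph.ConnectedComponent.mem_supp_iff] at hu hv
    have hr : G.Reachable u v := SimpleGraph.ConnectedComponent.eq.1 (hu.trans hv.symm)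
    obtain ⟨p⟩ := hr
    clear hu hv
    induction p with
    | nil => exact absurd rfl hne
    | @cons a b c hab p ih =>
      by_cases hbc : b = c
      · exact hbc ▸ hab
      · exact h _ _ _ hab (ih hbc) hne

theorem edit_adj {V : Type*} {G : SimpleGraph V} {M : Finset (Sym2 V)} {u v : V} :
    (edit G M).Adj u v ↔ u ≠ v ∧ ¬ (G.Adj u v ↔ s(u, v) ∈ M) := by
  simp only [edit, SimpleGraph.fromEdgeSet_adj, Set.mem_symmDiff, SimpleGraph.mem_edgeSet,
    Finset.mem_coe]
  tauto

theorem agreeOutside_iff {V : Type*} {D : Finset V} {G H : SimpleGraph V} :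
    AgreeOutside D G H ↔ ∀ u v, u ∉ D → v ∉ D → (G.Adj u v ↔ H.Adj u v) := by
  constructor
  · intro h u v hu hv
    have h' := congrArg (fun F => F.Adj ⟨u, by simpa using hu⟩ ⟨v, by simpa using hv⟩) h
    simpa using h'
  · intro h
    unfold AgreeOutside
    ext ⟨u, hu⟩ ⟨v, hv⟩
    simpa using h u v (by simpa using hu) (by simpa using hv)

/-! ### Consistency patterns

Both problems ask for label sets `D c` of marked vertices such that certain pairs of layers agree
outside of `D c`; they differ only in the relation that lists these pairs. -/

open Classical in
/-- The pairs inside `S` on which two graphs differ. -/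
noncomputable def diffPairs {V : Type*} (S : Finset V) (G H : SimpleGraph V) :
    Finset (Sym2 V) :=
  S.sym2.filter (· ∈ symmDiff G.edgeSet H.edgeSet)

theorem mem_diffPairs {V : Type*} {S : Finset V} {G H : SimpleGraph V} {u v : V} :
    s(u, v) ∈ diffPairs S G H ↔ u ∈ S ∧ v ∈ S ∧ ¬ (G.Adj u v ↔ H.Adj u v) := by
  simp only [diffPairs, Finset.mem_filter, Finset.mk_mem_sym2_iff, Set.mem_symmDiff,
    SimpleGraph.mem_edgeSet]
  tauto

/-- The graphs `H i` and the marked sets `D c` solve the problem with relation `E` on the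
subgraphs of the layers `G i` induced by `S`. -/
structure IsSolution {V κ : Type*} {ℓ : ℕ} (E : κ → Fin ℓ → Fin ℓ → Prop) (k d : ℕ)
    (G : Fin ℓ → SimpleGraph V) (S : Finset V) (H : Fin ℓ → SimpleGraph V)
    (D : κ → Finset V) : Prop where
  trans : ∀ i, ∀ u ∈ S, ∀ v ∈ S, ∀ w ∈ S, (H i).Adj u v → (H i).Adj v w → u ≠ w → (H i).Adj u w
  card_edit : ∀ i, (diffPairs S (G i) (H i)).card ≤ k
  card_mark : ∀ c, (D c).card ≤ d
  agree : ∀ c i j, E c i j → ∀ u ∈ S, ∀ v ∈ S, u ∉ D c → v ∉ D c →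
    ((H i).Adj u v ↔ (H j).Adj u v)

/-- The subgraphs of the layers induced by `S` have a solution. -/
def Solvable {V κ : Type*} {ℓ : ℕ} (E : κ → Fin ℓ → Fin ℓ → Prop) (k d : ℕ)
    (G : Fin ℓ → SimpleGraph V) (S : Finset V) : Prop :=
  ∃ H D, IsSolution E k d G S H D

/-- The problem with relation `E`, in terms of clusterings. -/
def HasConsistentClustering {V κ : Type*} {ℓ : ℕ} (E : κ → Fin ℓ → Fin ℓ → Prop) (k d : ℕ)
    (G : Fin ℓ → SimpleGraph V) : Prop :=
  ∃ M : Fin ℓ → Finset (Sym2 V), IsClustering G M ∧ IsBounded k M ∧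
    ∃ D : κ → Finset V, (∀ c, (D c).card ≤ d) ∧
      ∀ c i j, E c i j → AgreeOutside (D c) (edit (G i) (M i)) (edit (G j) (M j))

-- An edit set and the edited graph determine each other, so solutions can be phrased with edited
-- graphs on a vertex subset. The embedding `f` relabels that subset, as the output of the
-- kernelization does.
open Classical in
theorem hasConsistentClustering_comap_iff {V W κ : Type*} [Fintype W] {ℓ : ℕ}
    {E : κ → Fin ℓ → Fin ℓ → Prop} {k d : ℕ} {G : Fin ℓ → SimpleGraph V} (f : W ↪ V) :
    HasConsistentClustering E k d (fun i => (G i).comap f) ↔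
      Solvable E k d G (Finset.univ.map f) := by
  constructor
  · rintro ⟨M, hM, hk, D, hd, hD⟩
    -- The edited graphs are pushed forward along `f`; what happens outside the image is irrelevant
    -- to `Solvable`.
    refine ⟨fun i => (edit ((G i).comap f) (M i)).map f, fun c => (D c).map f, ?_, ?_, ?_, ?_⟩
    · simp only [Finset.mem_map, Finset.mem_univ, true_and, forall_exists_index,
        forall_apply_eq_imp_iff, SimpleGraph.map_adj_apply]
      intro i u v w huv hvw hne
      exact isClusterGraph_iff.1 (hM i).2 u v w huv hvw (fun h => hne (h ▸ rfl))
    · intro i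
      refine le_trans (Finset.card_le_card (t := (M i).image (Sym2.map f)) ?_)
        (Finset.card_image_le.trans (hk i))
      intro e he
      induction e with
      | _ u v =>
        rw [mem_diffPairs] at he
        obtain ⟨hu, hv, h⟩ := he
        obtain ⟨a, -, rfl⟩ := Finset.mem_map.1 hu
        obtain ⟨b, -, rfl⟩ := Finset.mem_map.1 hv
        refine Finset.mem_image.2 ⟨s(a, b), ?_, by simp⟩
        rw [SimpleGraph.map_adj_apply, edit_adj, SimpleGraph.comap_adj] at h
        by_contra hab
        by_cases hne : a = b
        · subst hne; simp at h
        · tauto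
    · intro c; simpa using hd c
    · simp only [Finset.mem_map, Finset.mem_univ, true_and, forall_exists_index,
        forall_apply_eq_imp_iff, SimpleGraph.map_adj_apply]
      intro c i j hE u v hu hv
      refine agreeOutside_iff.1 (hD c i j hE) u v (fun h => hu ⟨u, h, rfl⟩) (fun h => hv ⟨v, h, rfl⟩)
  · rintro ⟨H, D, hs⟩
    -- Editing exactly the pairs on which `G i` and `H i` differ turns the first into the second.
    have hed : ∀ i, edit ((G i).comap f) (Finset.univ.filter
        (· ∈ symmDiff ((G i).comap f).edgeSet ((H i).comap f).edgeSet)) = (H i).comap f := by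
      intro i
      ext u v
      rw [edit_adj]
      simp only [Finset.mem_filter, Finset.mem_univ, true_and, Set.mem_symmDiff,
        SimpleGraph.mem_edgeSet, SimpleGraph.comap_adj]
      by_cases h : u = v
      · subst h; simp
      · tauto
    refine ⟨fun i => Finset.univ.filter
      (· ∈ symmDiff ((G i).comap f).edgeSet ((H i).comap f).edgeSet), ?_, ?_,
      fun c => Finset.univ.filter (f · ∈ D c), ?_, ?_⟩
    · intro i
      refine ⟨?_, ?_⟩
      · intro e he
        simp only [Finset.mem_filter, Finset.mem_univ, true_and, Set.mem_symmDiff] at he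
        rcases he with h | h
        · exact SimpleGraph.not_isDiag_of_mem_edgeSet _ h.1
        · exact SimpleGraph.not_isDiag_of_mem_edgeSet _ h.1
      · rw [hed, isClusterGraph_iff]
        intro u v w huv hvw hne
        exact hs.trans i _ (by simp) (f v) (by simp) _ (by simp) huv hvw (fun h => hne (f.injective h))
    · intro i
      refine le_trans ?_ (hs.card_edit i)
      refine Finset.card_le_card_of_injOn (Sym2.map f) ?_ (Sym2.map.injective f.injective).injOn
      intro e he
      induction e with
      | _ u v =>
        simp only [Finset.coe_filter, Finset.mem_univ, true_and, Set.mem_ofPred_eq, Set.mem_symmDiff,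
          SimpleGraph.mem_edgeSet, SimpleGraph.comap_adj] at he
        rw [Sym2.map_mk, Finset.mem_coe]
        refine mem_diffPairs.2 ⟨by simp, by simp, ?_⟩
        tauto
    · intro c
      refine le_trans ?_ (hs.card_mark c)
      refine Finset.card_le_card_of_injOn f ?_ f.injective.injOn
      intro w hw
      simpa using hw
    · intro c i j hE
      rw [hed, hed, agreeOutside_iff]
      intro u v hu hv
      exact hs.agree c i j hE _ (by simp) _ (by simp) (by simpa using hu) (by simpa using hv)

theorem hasConsistentClustering_iff {V κ : Type*} [Fintype V] {ℓ : ℕ}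
    {E : κ → Fin ℓ → Fin ℓ → Prop} {k d : ℕ} {G : Fin ℓ → SimpleGraph V} :
    HasConsistentClustering E k d G ↔ Solvable E k d G Finset.univ := by
  have h := hasConsistentClustering_comap_iff (E := E) (k := k) (d := d) (G := G)
    (Function.Embedding.refl V)
  rw [Finset.map_refl] at h
  exact h

open Classical in
theorem diffPairs_mono {V : Type*} {S S' : Finset V} (h : S' ⊆ S) (G H : SimpleGraph V) :
    diffPairs S' G H ⊆ diffPairs S G H :=
  Finset.filter_subset_filter _ (Finset.sym2_mono h)

/-- All four conditions of a solution are universal over `S`, so they survive deleting vertices. -/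
theorem Solvable.mono {V κ : Type*} {ℓ : ℕ} {E : κ → Fin ℓ → Fin ℓ → Prop} {k d : ℕ}
    {G : Fin ℓ → SimpleGraph V} {S S' : Finset V} (hs : Solvable E k d G S) (h : S' ⊆ S) :
    Solvable E k d G S' := by
  obtain ⟨H, D, hs⟩ := hs
  exact ⟨H, D, fun i u hu v hv w hw => hs.trans i u (h hu) v (h hv) w (h hw),
    fun i => (Finset.card_le_card (diffPairs_mono h _ _)).trans (hs.card_edit i), hs.card_mark,
    fun c i j hE u hu v hv => hs.agree c i j hE u (h hu) v (h hv)⟩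

/-! ### Twins -/

/-- `x` lies in the closed neighborhood of `u`. -/
def ClosedAdj {V : Type*} (G : SimpleGraph V) (u x : V) : Prop := u = x ∨ G.Adj u x

theorem ClosedAdj.symm {V : Type*} {G : SimpleGraph V} {u x : V} (h : ClosedAdj G u x) :
    ClosedAdj G x u := h.imp Eq.symm SimpleGraph.Adj.symm

theorem ClosedAdj.refl {V : Type*} (G : SimpleGraph V) (u : V) : ClosedAdj G u u := Or.inl rfl

/-- `u` and `v` have the same closed neighborhood in every layer. -/
def Twin {V : Type*} {ℓ : ℕ} (G : Fin ℓ → SimpleGraph V) (u v : V) : Prop :=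
  ∀ i x, ClosedAdj (G i) u x ↔ ClosedAdj (G i) v x

namespace Twin

variable {V : Type*} {ℓ : ℕ} {G : Fin ℓ → SimpleGraph V} {u v w : V}

theorem refl (G : Fin ℓ → SimpleGraph V) (u : V) : Twin G u u := fun _ _ => Iff.rfl

theorem symm (h : Twin G u v) : Twin G v u := fun i x => (h i x).symm

theorem trans (h : Twin G u v) (h' : Twin G v w) : Twin G u w :=
  fun i x => (h i x).trans (h' i x)

theorem closedAdj (h : Twin G u v) (i : Fin ℓ) : ClosedAdj (G i) u v :=
  (h i v).2 (.refl _ _)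

end Twin

/-- Closed adjacency in an edited layer is an equivalence relation on `S` whose classes are the
clusters. -/
theorem IsSolution.closedAdj_trans {V κ : Type*} {ℓ : ℕ} {E : κ → Fin ℓ → Fin ℓ → Prop}
    {k d : ℕ} {G H : Fin ℓ → SimpleGraph V} {S : Finset V} {D : κ → Finset V}
    (hs : IsSolution E k d G S H D) {i : Fin ℓ} {u v w : V} (hu : u ∈ S) (hv : v ∈ S)
    (hw : w ∈ S) (huv : ClosedAdj (H i) u v) (hvw : ClosedAdj (H i) v w) :
    ClosedAdj (H i) u w := by
  rcases huv with rfl | huv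
  · exact hvw
  rcases hvw with rfl | hvw
  · exact Or.inr huv
  by_cases h : u = w
  · exact Or.inl h
  · exact Or.inr (hs.trans i u hu v hv w hw huv hvw h)

theorem IsSolution.closedAdj_congr {V κ : Type*} {ℓ : ℕ} {E : κ → Fin ℓ → Fin ℓ → Prop}
    {k d : ℕ} {G H : Fin ℓ → SimpleGraph V} {S : Finset V} {D : κ → Finset V}
    (hs : IsSolution E k d G S H D) {i : Fin ℓ} {u v w : V} (hu : u ∈ S) (hv : v ∈ S)
    (hw : w ∈ S) (huv : ClosedAdj (H i) u v) :
    ClosedAdj (H i) u w ↔ ClosedAdj (H i) v w :=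
  ⟨hs.closedAdj_trans hv hu hw huv.symm, hs.closedAdj_trans hu hv hw huv⟩

open Classical in
/-- A large set of twins lies in one cluster of every layer of a solution. -/
theorem IsSolution.closedAdj_of_twins {V κ : Type*} {ℓ : ℕ} {E : κ → Fin ℓ → Fin ℓ → Prop}
    {k d : ℕ} {G H : Fin ℓ → SimpleGraph V} {S T : Finset V} {D : κ → Finset V}
    (hs : IsSolution E k d G S H D) (hTS : T ⊆ S)
    (hT : ∀ a ∈ T, ∀ b ∈ T, Twin G a b) (hk : k + 2 ≤ T.card) (i : Fin ℓ) {a b : V}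
    (ha : a ∈ T) (hb : b ∈ T) : ClosedAdj (H i) a b := by
  by_contra hab
  have hne : a ≠ b := fun h => hab (Or.inl h)
  have hG : ∀ x ∈ T, ∀ y ∈ T, x ≠ y → (G i).Adj x y := fun x hx y hy h =>
    ((hT x hx y hy).closedAdj i).resolve_left h
  -- If `a` and `b` lie in different clusters, no `x` shares a cluster with both, although `T` is a
  -- clique in `G i`. So every `x ≠ a` in `T` has an edited pair with `a` or `b`, which makes `k +
  -- 1` distinct edits.
  have hcard : (T.erase a).card ≤ (diffPairs S (G i) (H i)).card := by
    refine Finset.card_le_card_of_injOn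
      (fun x => if (H i).Adj a x then s(b, x) else s(a, x)) ?_ ?_
    · intro x hx
      obtain ⟨hxa, hx⟩ := Finset.mem_erase.1 (Finset.mem_coe.1 hx)
      rw [Finset.mem_coe]
      dsimp only
      split_ifs with h
      · rw [mem_diffPairs]
        have hxb : b ≠ x := by rintro rfl; exact hab (Or.inr h)
        refine ⟨hTS hb, hTS hx, fun h' => hab (Or.inr ?_)⟩
        exact hs.trans i a (hTS ha) x (hTS hx) b (hTS hb) h (h'.1 (hG _ hb _ hx hxb)).symm hne
      · rw [mem_diffPairs]
        exact ⟨hTS ha, hTS hx, fun h' => h (h'.1 (hG _ ha _ hx hxa.symm))⟩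
    · intro x hx y hy hxy
      have hxa : x ≠ a := (Finset.mem_erase.1 (Finset.mem_coe.1 hx)).1
      have hya : y ≠ a := (Finset.mem_erase.1 (Finset.mem_coe.1 hy)).1
      dsimp only at hxy
      split_ifs at hxy <;> rw [Sym2.eq_iff] at hxy <;> grind
  rw [Finset.card_erase_of_mem ha] at hcard
  have := hs.card_edit i
  omega

open Classical in
/-- In every layer some vertex of a large set of twins is not edited. -/
theorem IsSolution.exists_unedited_twin {V κ : Type*} {ℓ : ℕ} {E : κ → Fin ℓ → Fin ℓ → Prop}
    {k d : ℕ} {G H : Fin ℓ → SimpleGraph V} {S T : Finset V} {D : κ → Finset V}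
    (hs : IsSolution E k d G S H D) (hTS : T ⊆ S)
    (hT : ∀ a ∈ T, ∀ b ∈ T, Twin G a b) (hk : k + 2 ≤ T.card) (i : Fin ℓ) :
    ∃ w ∈ T, ∀ x ∈ S, (ClosedAdj (H i) w x ↔ ClosedAdj (G i) w x) := by
  by_contra! hcon
  choose! g hgS hg using hcon
  have hg' : ∀ w ∈ T, ¬ (ClosedAdj (H i) w (g w) ↔ ClosedAdj (G i) w (g w)) := by
    intro w hw h
    have := hg w hw
    tauto
  -- `T` is a clique before and after editing, so an edit at `w` leads outside `T`. Hence the pairs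
  -- `s(w, g w)` are distinct and number more than `k`.
  have hgT : ∀ w ∈ T, g w ∉ T := fun w hw h => hg' w hw
    ⟨fun _ => (hT w hw _ h).closedAdj i, fun _ => hs.closedAdj_of_twins hTS hT hk i hw h⟩
  have hcard : T.card ≤ (diffPairs S (G i) (H i)).card := by
    refine Finset.card_le_card_of_injOn (fun w => s(w, g w)) ?_ ?_
    · intro w hw
      rw [Finset.mem_coe, mem_diffPairs]
      refine ⟨hTS hw, hgS w hw, fun h => hg' w hw ?_⟩
      simp only [ClosedAdj, h]
    · intro x hx y hy hxy
      rw [Sym2.eq_iff] at hxy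
      rcases hxy with h | h
      · exact h.1
      · exact absurd hx (h.1 ▸ hgT y hy)
  have := hs.card_edit i
  omega

open Classical in
/-- A vertex with many twins may be added. -/
theorem Solvable.insert_twin {V κ : Type*} {ℓ : ℕ} {E : κ → Fin ℓ → Fin ℓ → Prop}
    {k d : ℕ} {G : Fin ℓ → SimpleGraph V} {S T : Finset V}
    (hs : Solvable E k d G S) (hTS : T ⊆ S) {v : V}
    (hT : ∀ a ∈ T, Twin G a v) (hcard : k + d + 2 ≤ T.card) :
    Solvable E k d G (insert v S) := by
  by_cases hvS : v ∈ S
  · rwa [Finset.insert_eq_of_mem hvS]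
  obtain ⟨H, D, hs⟩ := hs
  have hT' : ∀ a ∈ T, ∀ b ∈ T, Twin G a b := fun a ha b hb => (hT a ha).trans (hT b hb).symm
  have hk : k + 2 ≤ T.card := by omega
  obtain ⟨t, ht⟩ : T.Nonempty := Finset.card_pos.1 (by omega)
  have hclique : ∀ i, ∀ a ∈ T, ClosedAdj (H i) t a := fun i a ha =>
    hs.closedAdj_of_twins hTS hT' hk i ht ha
  -- The cluster of `t` contains a twin that is not edited in layer `i`, so on `S` this cluster is
  -- the neighborhood of `v` in `G i`.
  have hnbr : ∀ i, ∀ x ∈ S, (ClosedAdj (H i) t x ↔ (G i).Adj v x) := by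
    intro i x hx
    obtain ⟨w, hw, h⟩ := hs.exists_unedited_twin hTS hT' hk i
    rw [hs.closedAdj_congr (hTS ht) (hTS hw) hx (hclique i w hw), h x hx, hT w hw i x]
    have : v ≠ x := by rintro rfl; exact hvS hx
    simp [ClosedAdj, this]
  -- In the new solution `v` is a copy of `t`. By `hnbr` no pair at `v` is then edited.
  let φ : V → V := fun x => if x = v then t else x
  have hφv : φ v = t := by simp [φ]
  have hφ : ∀ x ∈ S, φ x = x := by
    intro x hx
    have : x ≠ v := by rintro rfl; exact hvS hx
    simp [φ, this]
  have hφS : ∀ x ∈ insert v S, φ x ∈ S := by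
    intro x hx
    rcases Finset.mem_insert.1 hx with rfl | hx
    · rw [hφv]; exact hTS ht
    · rwa [hφ x hx]
  let H' : Fin ℓ → SimpleGraph V := fun i =>
    { Adj := fun x y => x ≠ y ∧ ClosedAdj (H i) (φ x) (φ y)
      symm := ⟨fun x y h => ⟨h.1.symm, h.2.symm⟩⟩
      loopless := ⟨fun x h => h.1 rfl⟩ }
  have hH' : ∀ i x y, (H' i).Adj x y ↔ x ≠ y ∧ ClosedAdj (H i) (φ x) (φ y) :=
    fun _ _ _ => Iff.rfl
  have hH'S : ∀ i, ∀ x ∈ S, ∀ y ∈ S, ((H' i).Adj x y ↔ (H i).Adj x y) := by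
    intro i x hx y hy
    rw [hH', hφ x hx, hφ y hy]
    constructor
    · rintro ⟨h, h'⟩; exact h'.resolve_left h
    · intro h; exact ⟨h.ne, Or.inr h⟩
  have hH'v : ∀ i, ∀ x ∈ S, ((H' i).Adj v x ↔ ClosedAdj (H i) t x) := by
    intro i x hx
    have : v ≠ x := by rintro rfl; exact hvS hx
    rw [hH', hφ x hx, hφv]
    simp [this]
  refine ⟨H', D, ?_, ?_, hs.card_mark, ?_⟩
  · intro i x hx y hy z hz hxy hyz hne
    exact ⟨hne, hs.closedAdj_trans (hφS x hx) (hφS y hy) (hφS z hz) hxy.2 hyz.2⟩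
  · intro i
    refine le_trans (Finset.card_le_card ?_) (hs.card_edit i)
    intro e he
    induction e with
    | _ x y =>
      rw [mem_diffPairs] at he ⊢
      obtain ⟨hx, hy, h⟩ := he
      rcases Finset.mem_insert.1 hx with rfl | hxS <;>
        rcases Finset.mem_insert.1 hy with rfl | hyS
      · simp at h
      · exact absurd (by rw [hH'v i y hyS, hnbr i y hyS]) h
      · refine absurd ?_ h
        rw [(G i).adj_comm, (H' i).adj_comm, hH'v i x hxS, hnbr i x hxS]
      · rw [hH'S i x hxS y hyS] at h
        exact ⟨hxS, hyS, h⟩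
  · intro c i j hE
    -- More than `d` twins leave an unmarked one. Its cluster, which `v` joins, looks the same in
    -- both layers outside `D c`.
    obtain ⟨u, huT, huD⟩ : ∃ u ∈ T, u ∉ D c := by
      by_contra! hcon
      have := Finset.card_le_card hcon
      have := hs.card_mark c
      omega
    have hS := hs.agree c i j hE
    have hv : ∀ x ∈ S, x ∉ D c → ((H' i).Adj v x ↔ (H' j).Adj v x) := by
      intro x hx hxD
      rw [hH'v i x hx, hH'v j x hx, hs.closedAdj_congr (hTS ht) (hTS huT) hx (hclique i u huT),
        hs.closedAdj_congr (hTS ht) (hTS huT) hx (hclique j u huT)]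
      simp only [ClosedAdj, hS u (hTS huT) x hx huD hxD]
    intro x hx y hy hxD hyD
    rcases Finset.mem_insert.1 hx with rfl | hxS <;>
        rcases Finset.mem_insert.1 hy with rfl | hyS
    · simp
    · exact hv y hyS hyD
    · rw [(H' i).adj_comm, (H' j).adj_comm]; exact hv x hxS hxD
    · rw [hH'S i x hxS y hyS, hH'S j x hxS y hyS]; exact hS x hxS y hyS hxD hyD

/-! ### Isolated twin classes -/

/-- In every layer the closed neighborhood of `v` is its class of twins. -/
def IsIsolated {V : Type*} {ℓ : ℕ} (G : Fin ℓ → SimpleGraph V) (v : V) : Prop :=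
  ∀ i x, (G i).Adj v x → Twin G v x

theorem IsIsolated.of_twin {V : Type*} {ℓ : ℕ} {G : Fin ℓ → SimpleGraph V} {u v : V}
    (hu : IsIsolated G u) (h : Twin G u v) : IsIsolated G v := by
  intro i x hx
  rcases (h i x).2 (Or.inr hx) with rfl | hx
  · exact h.symm
  · exact h.symm.trans (hu i x hx)

theorem IsIsolated.of_adj {V : Type*} {ℓ : ℕ} {G : Fin ℓ → SimpleGraph V} {u v : V}
    (hu : IsIsolated G u) {i : Fin ℓ} (h : (G i).Adj u v) : IsIsolated G v :=
  hu.of_twin (hu i v h)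

open Classical in
/-- The isolated twin classes may be added. -/
theorem Solvable.univ_of_not_isIsolated {V κ : Type*} [Fintype V] {ℓ : ℕ}
    {E : κ → Fin ℓ → Fin ℓ → Prop} {k d : ℕ} {G : Fin ℓ → SimpleGraph V}
    (hs : Solvable E k d G (Finset.univ.filter (¬ IsIsolated G ·))) :
    Solvable E k d G Finset.univ := by
  obtain ⟨H, D, hs⟩ := hs
  -- Isolated classes keep their original edges, the other vertices follow `H`, and no edge joins
  -- the two kinds.
  let H' : Fin ℓ → SimpleGraph V := fun i =>
    { Adj := fun x y => (IsIsolated G x ∧ (G i).Adj x y) ∨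
        (¬ IsIsolated G x ∧ ¬ IsIsolated G y ∧ (H i).Adj x y)
      symm := ⟨by
        rintro x y (⟨h, h'⟩ | ⟨h, h', h''⟩)
        · exact Or.inl ⟨h.of_adj h', h'.symm⟩
        · exact Or.inr ⟨h', h, h''.symm⟩⟩
      loopless := ⟨by
        rintro x (⟨h, h'⟩ | ⟨h, h', h''⟩)
        · exact h'.ne rfl
        · exact h''.ne rfl⟩ }
  have hiso : ∀ i x y, IsIsolated G x → ((H' i).Adj x y ↔ (G i).Adj x y) := by
    intro i x y hx
    simp [H', hx]
  have hnon : ∀ i x y, ¬ IsIsolated G x → ¬ IsIsolated G y →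
      ((H' i).Adj x y ↔ (H i).Adj x y) := by
    intro i x y hx hy
    simp [H', hx, hy]
  have hcross : ∀ i x y, (H' i).Adj x y → (IsIsolated G x ↔ IsIsolated G y) := by
    rintro i x y (⟨h, h'⟩ | ⟨h, h', -⟩)
    · exact ⟨fun h => h.of_adj h', fun h => h.of_adj h'.symm⟩
    · tauto
  refine ⟨H', D, ?_, ?_, hs.card_mark, ?_⟩
  · intro i x _ y _ z _ hxy hyz hne
    by_cases hx : IsIsolated G x
    · have hy := (hcross i x y hxy).1 hx
      rw [hiso i _ _ hx] at hxy ⊢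
      rw [hiso i _ _ hy] at hyz
      exact ((hx i y hxy i z).2 (Or.inr hyz)).resolve_left hne
    · have hy := (not_congr (hcross i x y hxy)).1 hx
      have hz := (not_congr (hcross i y z hyz)).1 hy
      rw [hnon i _ _ hx hz]
      exact hs.trans i x (by simpa using hx) y (by simpa using hy) z (by simpa using hz)
        ((hnon i _ _ hx hy).1 hxy) ((hnon i _ _ hy hz).1 hyz) hne
  · intro i
    refine le_trans (Finset.card_le_card ?_) (hs.card_edit i)
    intro e he
    induction e with
    | _ x y =>
      rw [mem_diffPairs] at he ⊢
      have hx : ¬ IsIsolated G x := fun hx => he.2.2 (hiso i x y hx).symm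
      have hy : ¬ IsIsolated G y := fun hy => he.2.2 (by
        rw [(G i).adj_comm, (H' i).adj_comm]; exact (hiso i y x hy).symm)
      rw [hnon i x y hx hy] at he
      simpa [hx, hy] using he.2.2
  · intro c i j hE x _ y _ hxD hyD
    by_cases hx : IsIsolated G x
    -- A neighbor of an isolated vertex in one layer is its twin, hence its neighbor in every layer.
    · rw [hiso i x y hx, hiso j x y hx]
      exact ⟨fun h => ((hx i y h).closedAdj j).resolve_left h.ne,
        fun h => ((hx j y h).closedAdj i).resolve_left h.ne⟩
    by_cases hy : IsIsolated G y
    · rw [(H' i).adj_comm, (H' j).adj_comm, hiso i y x hy, hiso j y x hy]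
      exact ⟨fun h => ((hy i x h).closedAdj j).resolve_left h.ne,
        fun h => ((hy j x h).closedAdj i).resolve_left h.ne⟩
    rw [hnon i x y hx hy, hnon j x y hx hy]
    exact hs.agree c i j hE x (by simpa using hx) y (by simpa using hy) hxD hyD

end ClusterEditing

namespace ClusterEditing

/-! ### The kernel -/

open Classical in
/-- The number of smaller twins of `v`. -/
noncomputable def twinRank {ℓ n : ℕ} (G : Fin ℓ → SimpleGraph (Fin n)) (v : Fin n) : ℕ :=
  (Finset.univ.filter fun u => u < v ∧ Twin G u v).card

theorem twinRank_lt {ℓ n : ℕ} {G : Fin ℓ → SimpleGraph (Fin n)} {u v : Fin n} (h : u < v)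
    (ht : Twin G u v) : twinRank G u < twinRank G v := by
  classical
  refine Finset.card_lt_card (Finset.ssubset_iff_subset_ne.2 ⟨?_, fun heq => ?_⟩)
  · intro x hx
    simp only [Finset.mem_filter, Finset.mem_univ, true_and] at hx ⊢
    exact ⟨hx.1.trans h, hx.2.trans ht⟩
  · have : u ∈ Finset.univ.filter fun x => x < u ∧ Twin G x u := by
      rw [heq]; simp [h, ht]
    simp at this

/-- Rank grows strictly along a twin class, so at most `τ` of its members have rank below `τ`. -/
theorem twinRank_injOn {ℓ n : ℕ} (G : Fin ℓ → SimpleGraph (Fin n)) (v : Fin n) :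
    Set.InjOn (twinRank G) {u | Twin G u v} := by
  intro x hx y hy hxy
  rcases lt_trichotomy x y with h | h | h
  · exact absurd hxy (twinRank_lt h (Twin.trans hx (Twin.symm hy))).ne
  · exact h
  · exact absurd hxy (twinRank_lt h (Twin.trans hy (Twin.symm hx))).ne'

theorem exists_twin_twinRank_eq_zero {ℓ n : ℕ} (G : Fin ℓ → SimpleGraph (Fin n)) (v : Fin n) :
    ∃ u, Twin G u v ∧ twinRank G u = 0 := by
  classical
  obtain ⟨u, hu, hmin⟩ := Finset.exists_min_image (Finset.univ.filter fun u => Twin G u v) id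
    ⟨v, by simp [Twin.refl]⟩
  simp only [Finset.mem_filter, Finset.mem_univ, true_and, id] at hu hmin
  refine ⟨u, hu, Finset.card_eq_zero.2 (Finset.filter_eq_empty_iff.2 ?_)⟩
  rintro x - ⟨hx, hxt⟩
  exact absurd (hmin x (hxt.trans hu)) (not_le.2 hx)

open Classical in
/-- The vertices of the kernel: those in no isolated twin class, at most `τ` from every class. -/
noncomputable def kernelVerts {ℓ n : ℕ} (G : Fin ℓ → SimpleGraph (Fin n)) (τ : ℕ) :
    Finset (Fin n) :=
  Finset.univ.filter fun v => ¬ IsIsolated G v ∧ twinRank G v < τ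

theorem mem_kernelVerts {ℓ n : ℕ} {G : Fin ℓ → SimpleGraph (Fin n)} {τ : ℕ} {v : Fin n} :
    v ∈ kernelVerts G τ ↔ ¬ IsIsolated G v ∧ twinRank G v < τ := by
  simp [kernelVerts]

theorem exists_twin_mem_kernelVerts {ℓ n : ℕ} {G : Fin ℓ → SimpleGraph (Fin n)} {τ : ℕ}
    (hτ : 0 < τ) {v : Fin n} (hv : ¬ IsIsolated G v) : ∃ u ∈ kernelVerts G τ, Twin G u v := by
  obtain ⟨u, hu, h0⟩ := exists_twin_twinRank_eq_zero G v
  exact ⟨u, mem_kernelVerts.2 ⟨fun h => hv (h.of_twin hu), h0 ▸ hτ⟩, hu⟩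

-- The omitted twins return one at a time in increasing order. When a vertex of rank at least `k + d
-- + 2` is due, all its smaller twins are already present and serve as the set `T` of
-- `Solvable.insert_twin`.
open Classical in
theorem solvable_kernelVerts_iff {κ : Type*} {ℓ n : ℕ} {E : κ → Fin ℓ → Fin ℓ → Prop} {k d : ℕ}
    {G : Fin ℓ → SimpleGraph (Fin n)} :
    Solvable E k d G (kernelVerts G (k + d + 2)) ↔ Solvable E k d G Finset.univ := by
  refine ⟨fun h => Solvable.univ_of_not_isIsolated ?_, fun h => h.mono (Finset.subset_univ _)⟩
  -- At stage `m` all non-isolated vertices below `m` have been restored.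
  have key : ∀ m ≤ n, Solvable E k d G (Finset.univ.filter fun v : Fin n =>
      ¬ IsIsolated G v ∧ (twinRank G v < k + d + 2 ∨ v.val < m)) := by
    intro m
    induction m with
    | zero => intro _; simpa [kernelVerts] using h
    | succ m ih =>
      intro hm
      have ih := ih (by omega)
      let v : Fin n := ⟨m, hm⟩
      by_cases hv : ¬ IsIsolated G v ∧ ¬ twinRank G v < k + d + 2
      · have := ih.insert_twin (T := Finset.univ.filter fun u => u < v ∧ Twin G u v) (v := v)
          ?_ ?_ ?_
        · refine this.mono ?_
          intro x hx
          simp only [Finset.mem_filter, Finset.mem_univ, true_and, Finset.mem_insert] at hx ⊢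
          by_cases hxv : x = v
          · exact Or.inl hxv
          · refine Or.inr ⟨hx.1, hx.2.imp id fun h => ?_⟩
            have : x.val ≠ m := fun h => hxv (Fin.ext h)
            omega
        · intro x hx
          simp only [Finset.mem_filter, Finset.mem_univ, true_and] at hx ⊢
          exact ⟨fun h => hv.1 (h.of_twin hx.2), Or.inr hx.1⟩
        · intro x hx
          simp only [Finset.mem_filter, Finset.mem_univ, true_and] at hx
          exact hx.2
        · exact not_lt.1 hv.2
      · refine ih.mono ?_
        intro x hx
        simp only [Finset.mem_filter, Finset.mem_univ, true_and] at hx ⊢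
        refine ⟨hx.1, ?_⟩
        rcases hx.2 with h | h
        · exact Or.inl h
        · by_cases hxv : x = v
          · subst hxv; left; by_contra h'; exact hv ⟨hx.1, h'⟩
          · have : x.val ≠ m := fun h => hxv (Fin.ext h)
            right; omega
  refine (key n le_rfl).mono ?_
  intro x hx
  simp only [Finset.mem_filter, Finset.mem_univ, true_and] at hx ⊢
  exact ⟨hx, Or.inr x.2⟩

/-- Twins within the kernel are twins. -/
theorem twin_of_forall_kernelVerts {ℓ n : ℕ} {G : Fin ℓ → SimpleGraph (Fin n)} {τ : ℕ}
    (hτ : 0 < τ) {u v : Fin n} (hu : ¬ IsIsolated G u) (hv : ¬ IsIsolated G v)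
    (h : ∀ i, ∀ x ∈ kernelVerts G τ, (ClosedAdj (G i) u x ↔ ClosedAdj (G i) v x)) :
    Twin G u v := by
  have main : ∀ u v, ¬ IsIsolated G u →
      (∀ i, ∀ x ∈ kernelVerts G τ, (ClosedAdj (G i) u x ↔ ClosedAdj (G i) v x)) →
      ∀ i x, ClosedAdj (G i) u x → ClosedAdj (G i) v x := by
    intro u v hu h i x hx
    have hxi : ¬ IsIsolated G x := by
      intro hxi
      rcases hx with rfl | hx
      · exact hu hxi
      · exact hu (hxi.of_adj hx.symm)
    -- A neighbor `x` outside the kernel is replaced by a kernel twin `y`, which sees `u` and `v`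
    -- exactly as `x` does.
    obtain ⟨y, hy, hyx⟩ := exists_twin_mem_kernelVerts hτ hxi
    have h1 := ((hyx i u).2 hx.symm).symm
    exact ((hyx i v).1 ((h i y hy).1 h1).symm).symm
  exact fun i x => ⟨main u v hu h i x, main v u hv (fun i x hx => (h i x hx).symm) i x⟩

open Classical in
/-- The kernel of a solvable instance is small. -/
theorem IsSolution.card_kernelVerts_le {κ : Type*} [Fintype κ] {ℓ n : ℕ}
    {E : κ → Fin ℓ → Fin ℓ → Prop} {k d τ : ℕ} (hτ : 0 < τ)
    {G H : Fin ℓ → SimpleGraph (Fin n)} {D : κ → Finset (Fin n)}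
    (hE : ∀ i j, Relation.EqvGen (fun i j => ∃ c, E c i j) i j)
    (hs : IsSolution E k d G (kernelVerts G τ) H D) :
    (kernelVerts G τ).card ≤ 2 * (k * ℓ) + Fintype.card κ * d +
      τ * (2 * (k * ℓ) + Fintype.card κ * d * ℓ) := by
  set K := kernelVerts G τ with hK
  -- `X` collects the endpoints of edited pairs over all layers, `Y` below the marked vertices over
  -- all labels.
  let X : Finset (Fin n) := Finset.univ.biUnion fun i =>
    (diffPairs K (G i) (H i)).biUnion Sym2.toFinset
  let Y : Finset (Fin n) := Finset.univ.biUnion D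
  have hX : X.card ≤ 2 * (k * ℓ) := by
    refine (Finset.card_biUnion_le_card_mul _ _ (k * 2) fun i _ => ?_).trans ?_
    · refine (Finset.card_biUnion_le_card_mul _ _ 2 fun e _ => ?_).trans ?_
      · rw [Sym2.card_toFinset]; split_ifs <;> omega
      · exact Nat.mul_le_mul_right _ (hs.card_edit i)
    · simp only [Finset.card_univ, Fintype.card_fin]; apply le_of_eq; ring
  have hY : Y.card ≤ Fintype.card κ * d :=
    Finset.card_biUnion_le_card_mul _ _ d fun c _ => hs.card_mark c
  have hXmem : ∀ i, ∀ u ∈ K, ∀ v ∈ K, u ∉ X → ((G i).Adj u v ↔ (H i).Adj u v) := by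
    intro i u hu v hv huX
    by_contra hne
    refine huX (Finset.mem_biUnion.2 ⟨i, Finset.mem_univ _, Finset.mem_biUnion.2
      ⟨s(u, v), mem_diffPairs.2 ⟨hu, hv, hne⟩, by simp⟩⟩)
  -- Agreement travels along chains of related layers, so outside `Y` all edited layers coincide.
  have hH : ∀ i j, ∀ u ∈ K, ∀ v ∈ K, u ∉ Y → v ∉ Y → ((H i).Adj u v ↔ (H j).Adj u v) := by
    intro i j u hu v hv huY hvY
    have huD : ∀ c, u ∉ D c := fun c h => huY (Finset.mem_biUnion.2 ⟨c, Finset.mem_univ _, h⟩)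
    have hvD : ∀ c, v ∉ D c := fun c h => hvY (Finset.mem_biUnion.2 ⟨c, Finset.mem_univ _, h⟩)
    induction hE i j with
    | rel i j h => obtain ⟨c, h⟩ := h; exact hs.agree c i j h u hu v hv (huD c) (hvD c)
    | refl => rfl
    | symm _ _ _ ih => exact ih.symm
    | trans _ _ _ _ _ ih ih' => exact ih.trans ih'
  let R := K \ (X ∪ Y)
  have hR : ∀ v ∈ R, v ∈ K ∧ v ∉ X ∧ v ∉ Y := by
    intro v hv
    simpa [R] using hv
  -- Unmarked vertices that share one cluster share it in every layer; as neither is edited, their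
  -- original closed neighborhoods agree on the kernel.
  have htwin : ∀ u ∈ R, ∀ v ∈ R, ∀ i, ClosedAdj (H i) u v → Twin G u v := by
    intro u hu v hv i huv
    obtain ⟨huK, huX, huY⟩ := hR u hu
    obtain ⟨hvK, hvX, hvY⟩ := hR v hv
    refine twin_of_forall_kernelVerts hτ (mem_kernelVerts.1 huK).1 (mem_kernelVerts.1 hvK).1 ?_
    intro j x hx
    have huv' : ClosedAdj (H j) u v := huv.imp id (hH i j u huK v hvK huY hvY).1
    have := hs.closedAdj_congr huK hvK hx huv'
    simpa only [ClosedAdj, hXmem j u huK x hx huX, hXmem j v hvK x hx hvX] using this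
  -- A pair names the cluster of a vertex in a layer. Layer `0` is enough for unmarked vertices of
  -- `X`, since `hH` moves their adjacencies to `R` there; marked vertices need every layer.
  let W : Finset (Fin n × Fin ℓ) :=
    if h : 0 < ℓ then (X ×ˢ {⟨0, h⟩}) ∪ (Y ×ˢ Finset.univ) else ∅
  have hW : W.card ≤ 2 * (k * ℓ) + Fintype.card κ * d * ℓ := by
    by_cases h : 0 < ℓ
    · simp only [W, h, dite_true]
      refine (Finset.card_union_le _ _).trans (Nat.add_le_add ?_ ?_)
      · simpa using hX
      · simpa using Nat.mul_le_mul_right ℓ hY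
    · simp [W, h]
  -- A non-isolated `v` has a non-twin neighbor `u`, which may be taken in the kernel. That edge is
  -- not edited, so by `htwin` the vertex `u` is not in `R`, hence touched or marked.
  have hwit : ∀ v ∈ R, ∃ p ∈ W, p.1 ∈ K ∧ (H p.2).Adj p.1 v := by
    intro v hv
    obtain ⟨hvK, hvX, hvY⟩ := hR v hv
    have hvi := (mem_kernelVerts.1 hvK).1
    simp only [IsIsolated, not_forall] at hvi
    obtain ⟨i, x, hx, hnt⟩ := hvi
    have hℓ : 0 < ℓ := i.pos
    obtain ⟨u, huK, hux⟩ := exists_twin_mem_kernelVerts hτ (v := x)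
      (fun h => (mem_kernelVerts.1 hvK).1 (h.of_adj hx.symm))
    have hnu : ¬ Twin G v u := fun h => hnt (h.trans hux)
    have huv : (G i).Adj v u :=
      ((hux i v).2 (Or.inr hx.symm)).symm.resolve_left fun h => hnu (h ▸ Twin.refl G v)
    have huvH : (H i).Adj u v := ((hXmem i v hvK u huK hvX).1 huv).symm
    by_cases huY : u ∈ Y
    · exact ⟨(u, i), by simp [W, hℓ, huY], huK, huvH⟩
    · by_cases huX : u ∈ X
      · exact ⟨(u, ⟨0, hℓ⟩), by simp [W, hℓ, huX], huK, (hH i _ u huK v hvK huY hvY).1 huvH⟩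
      · exact absurd (htwin v hv u (Finset.mem_sdiff.2 ⟨huK, by simp [huX, huY]⟩) i (Or.inr huvH.symm)) hnu
  have hRcard : R.card ≤ τ * W.card := by
    rcases R.eq_empty_or_nonempty with h0 | ⟨v₀, hv₀⟩
    · simp [h0]
    have : Nonempty (Fin n × Fin ℓ) := ⟨(hwit v₀ hv₀).choose⟩
    choose! g hgW hgK hg using hwit
    refine (Finset.card_le_mul_card_image_of_maps_to hgW τ ?_)
    -- Vertices of `R` assigned to the same `p` lie in one cluster, so they are twins, and their
    -- ranks are distinct numbers below `τ`.
    intro p _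
    rcases (Finset.filter (fun v => g v = p) R).eq_empty_or_nonempty with h0 | ⟨v, hv⟩
    · simp [h0]
    obtain ⟨hvR, hgv⟩ := Finset.mem_filter.1 hv
    rw [← Finset.card_range τ]
    refine Finset.card_le_card_of_injOn (twinRank G) ?_ ((twinRank_injOn G v).mono ?_)
    · intro u hu
      have := (hR u (Finset.mem_filter.1 hu).1).1
      simpa using (mem_kernelVerts.1 this).2
    · intro u hu
      obtain ⟨huR, hgu⟩ := Finset.mem_filter.1 (Finset.mem_coe.1 hu)
      refine htwin u huR v hvR p.2 ?_
      have h1 := hg u huR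
      have h2 := hg v hvR
      rw [hgu] at h1; rw [hgv] at h2
      refine hs.closedAdj_trans (hR u huR).1 (hgv ▸ hgK v hvR) (hR v hvR).1
        (Or.inr h1.symm) (Or.inr h2)
  have hsplit : K ⊆ (X ∪ Y) ∪ R := by
    intro x hx
    by_cases h : x ∈ X ∪ Y
    · exact Finset.mem_union_left _ h
    · exact Finset.mem_union_right _ (Finset.mem_sdiff.2 ⟨hx, h⟩)
  calc K.card ≤ ((X ∪ Y) ∪ R).card := Finset.card_le_card hsplit
    _ ≤ (X ∪ Y).card + R.card := Finset.card_union_le _ _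
    _ ≤ (X.card + Y.card) + R.card := Nat.add_le_add_right (Finset.card_union_le _ _) _
    _ ≤ _ := Nat.add_le_add (Nat.add_le_add hX hY)
      (hRcard.trans (Nat.mul_le_mul_left _ hW))

end ClusterEditing

namespace WordRAM

/-! ### Rules for programs -/

/-- Started in `s`, the program halts after at most `T` steps in a state with the property `Q`. -/
def Runs (B : ℕ) (p : Prog) (s : State) (T : ℕ) (Q : State → Prop) : Prop :=
  ∃ s' t, Exec B p s s' t ∧ t ≤ T ∧ Q s'

@[simp] theorem State.setReg_reg (s : State) (r v x : ℕ) :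
    (s.setReg r v).reg x = if x = r then v else s.reg x := by
  simp [State.setReg, Function.update_apply]

@[simp] theorem State.setReg_mem (s : State) (r v : ℕ) : (s.setReg r v).mem = s.mem := rfl

@[simp] theorem State.setMem_reg (s : State) (a x v : ℕ) : (s.setMem a x v).reg = s.reg := rfl

@[simp] theorem State.setMem_mem (s : State) (a x v b y : ℕ) :
    (s.setMem a x v).mem b y = if b = a ∧ y = x then v else s.mem b y := by
  by_cases h : b = a
  · subst h; simp [State.setMem, Function.update_apply]
  · simp [State.setMem, h]

theorem Runs.mono {B : ℕ} {p : Prog} {s : State} {T T' : ℕ} {Q Q' : State → Prop}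
    (h : Runs B p s T Q) (hT : T ≤ T') (hQ : ∀ s', Q s' → Q' s') : Runs B p s T' Q' := by
  obtain ⟨s', t, he, ht, hq⟩ := h
  exact ⟨s', t, he, ht.trans hT, hQ _ hq⟩

theorem Runs.assign {B : ℕ} {s : State} {r : ℕ} {e : Expr} {Q : State → Prop}
    (he : e.Fits B s) (hQ : Q (s.setReg r (e.eval s))) :
    Runs B (.assign r e) s (e.cost + 1) Q :=
  ⟨_, _, .assign s r e he, le_rfl, hQ⟩

theorem Runs.store {B : ℕ} {s : State} {a : ℕ} {x e : Expr} {Q : State → Prop}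
    (hx : x.Fits B s) (he : e.Fits B s) (hQ : Q (s.setMem a (x.eval s) (e.eval s))) :
    Runs B (.store a x e) s (x.cost + e.cost + 1) Q :=
  ⟨_, _, .store s a x e hx he, le_rfl, hQ⟩

theorem Runs.seq {B : ℕ} {p q : Prog} {s : State} {T₁ T₂ : ℕ} {Q₁ Q₂ : State → Prop}
    (hp : Runs B p s T₁ Q₁) (hq : ∀ s', Q₁ s' → Runs B q s' T₂ Q₂) :
    Runs B (.seq p q) s (T₁ + T₂) Q₂ := by
  obtain ⟨s', t, he, ht, h⟩ := hp
  obtain ⟨s'', t', he', ht', h'⟩ := hq s' h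
  exact ⟨s'', t + t', .seq he he', by omega, h'⟩

theorem Runs.ite {B : ℕ} {c : Expr} {p q : Prog} {s : State} {T : ℕ} {Q : State → Prop}
    (hc : c.Fits B s) (hp : c.eval s ≠ 0 → Runs B p s T Q) (hq : c.eval s = 0 → Runs B q s T Q) :
    Runs B (.ite c p q) s (c.cost + 1 + T) Q := by
  by_cases h : c.eval s = 0
  · obtain ⟨s', t, he, ht, h'⟩ := hq h
    exact ⟨s', _, .ite_false hc h he, by omega, h'⟩
  · obtain ⟨s', t, he, ht, h'⟩ := hp h
    exact ⟨s', _, .ite_true hc h he, by omega, h'⟩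

/-- Run `p` for the values `0, 1, …` of register `r` that are smaller than register `m`. -/
def forLoop (r m : ℕ) (p : Prog) : Prog :=
  .seq (.assign r (.const 0))
    (.while (.lt (.reg r) (.reg m)) (.seq p (.assign r (.add (.reg r) (.const 1)))))

/-- A pass costs `T` plus 4 for the test and 4 for the increment. Initialization and the last test
add 6, absorbed into `N * 6` because `N` is positive. -/
theorem Runs.forLoop {B r m N T : ℕ} {p : Prog} {s : State} (I : ℕ → State → Prop)
    (hN : 0 < N) (hB : N + 1 < B) (h0 : I 0 (s.setReg r 0))
    (hI : ∀ j ≤ N, ∀ s, I j s → s.reg r = j ∧ s.reg m = N)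
    (step : ∀ j < N, ∀ s, I j s →
      Runs B p s T (fun s' => s'.reg r = j ∧ I (j + 1) (s'.setReg r (j + 1)))) :
    Runs B (forLoop r m p) s (N * (T + 14)) (I N) := by
  have hw : ∀ x j, j + x = N → ∀ s, I j s →
      Runs B (.while (.lt (.reg r) (.reg m)) (.seq p (.assign r (.add (.reg r) (.const 1)))))
        s (x * (T + 8) + 4) (I N) := by
    intro x
    induction x with
    | zero =>
      intro j hj s hs
      obtain rfl : j = N := hj
      obtain ⟨h1, h2⟩ := hI j le_rfl s hs
      refine ⟨s, _, .while_false ?_ ?_, ?_, hs⟩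
      · simp only [Expr.Fits, h1, h2]; omega
      · simp [Expr.eval, h1, h2]
      · simp [Expr.cost]
    | succ x ih =>
      intro j hj s hs
      obtain ⟨h1, h2⟩ := hI j (by omega) s hs
      obtain ⟨s', t, he, ht, hr, hs'⟩ := step j (by omega) s hs
      obtain ⟨s'', t', he', ht', hs''⟩ := ih (j + 1) (by omega) _ hs'
      refine ⟨s'', _, .while_true (t₂ := t') ?_ ?_ (.seq he (.assign s' r _ ?_)) ?_, ?_, hs''⟩
      · simp only [Expr.Fits, h1, h2]; omega
      · have : j < N := by omega
        simp [Expr.eval, h1, h2, this]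
      · simp only [Expr.Fits, Expr.eval, hr]; omega
      · simpa [Expr.eval, hr] using he'
      · simp only [Expr.cost]
        rw [Nat.succ_mul]; omega
  obtain ⟨s', t, he, ht, hs'⟩ := hw N 0 (by omega) _ h0
  refine ⟨s', 2 + t, .seq (.assign s r (.const 0) ?_) he, ?_, hs'⟩
  · simp only [Expr.Fits]; omega
  · have : N * (T + 14) = N * (T + 8) + N * 6 := by ring
    omega

/-! ### Programs that compute a number -/

/-- The registers below `L` and the arrays are unchanged. -/
def Frame (L : ℕ) (s s' : State) : Prop := (∀ r < L, s'.reg r = s.reg r) ∧ s'.mem = s.mem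

theorem Frame.refl (L : ℕ) (s : State) : Frame L s s := ⟨fun _ _ => rfl, rfl⟩

theorem Frame.trans {L L' : ℕ} {s s' s'' : State} (h : Frame L s s') (h' : Frame L' s' s'')
    (hL : L ≤ L') : Frame L s s'' :=
  ⟨fun r hr => (h'.1 r (by omega)).trans (h.1 r hr), h'.2.trans h.2⟩

theorem Frame.setReg {L r v : ℕ} {s s' : State} (h : Frame L s s') (hr : L ≤ r) :
    Frame L s (s'.setReg r v) := by
  refine ⟨fun x hx => ?_, h.2⟩
  have : x ≠ r := by omega
  simp [this, h.1 x hx]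

/-- The program writes `v` into register `L`; the registers below `L` and the arrays keep their
contents. -/
def Computes (B T L : ℕ) (p : Prog) (s : State) (v : ℕ) : Prop :=
  Runs B p s T fun s' => Frame L s s' ∧ s'.reg L = v

theorem Computes.mono {B T T' L : ℕ} {p : Prog} {s : State} {v : ℕ} (h : Computes B T L p s v)
    (hT : T ≤ T') : Computes B T' L p s v :=
  Runs.mono h hT fun _ h => h

theorem Computes.assign {B L : ℕ} {e : Expr} {s : State} {v : ℕ} (he : e.Fits B s)
    (hv : e.eval s = v) : Computes B (e.cost + 1) L (.assign L e) s v :=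
  Runs.assign he ⟨(Frame.refl L s).setReg le_rfl, by simp [hv]⟩

/-- Registers serve as a stack: intermediate results sit at `L` or above, where the outer
computation may overwrite them. -/
theorem Computes.bind {B T₁ T₂ L L' : ℕ} {p q : Prog} {s : State} {v v' : ℕ} (hL : L ≤ L')
    (hp : Computes B T₁ L' p s v)
    (hq : ∀ s', Frame L' s s' → s'.reg L' = v → Computes B T₂ L q s' v') :
    Computes B (T₁ + T₂) L (.seq p q) s v' := by
  refine Runs.seq hp fun s' hs' => Runs.mono (hq s' hs'.1 hs'.2) le_rfl ?_
  rintro s'' ⟨h, hv⟩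
  exact ⟨⟨fun r hr => (h.1 r hr).trans (hs'.1.1 r (by omega)), h.2.trans hs'.1.2⟩, hv⟩

/-- Sum up, in register `L`, the numbers that `p` computes in register `L + 2` for the values
`0, 1, …` of register `L + 1` that are smaller than register `m`. -/
def sumLoop (L m : ℕ) (p : Prog) : Prog :=
  .seq (.assign L (.const 0))
    (forLoop (L + 1) m (.seq p (.assign L (.add (.reg L) (.reg (L + 2))))))

theorem Computes.sumLoop {B T L m N : ℕ} {p : Prog} {s : State} {f : ℕ → ℕ} (hm : m < L)
    (hN : s.reg m = N) (hpos : 0 < N) (hNB : N + 1 < B) (hf : ∑ j ∈ Finset.range N, f j < B)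
    (hp : ∀ j < N, ∀ s', Frame L s s' → s'.reg (L + 1) = j → Computes B T (L + 2) p s' (f j)) :
    Computes B (N * (T + 20)) L (sumLoop L m p) s (∑ j ∈ Finset.range N, f j) := by
  have h0 : Runs B (.assign L (.const 0)) s 2 fun s' => Frame L s s' ∧ s'.reg L = 0 :=
    Computes.assign (by simp only [Expr.Fits]; omega) rfl
  have h1 : ∀ s', Frame L s s' ∧ s'.reg L = 0 → Runs B (forLoop (L + 1) m
      (.seq p (.assign L (.add (.reg L) (.reg (L + 2)))))) s' (N * ((T + 4) + 14))
      (fun s'' => Frame L s s'' ∧ s''.reg L = ∑ j ∈ Finset.range N, f j) := by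
    rintro s₁ ⟨hF₁, hs₁⟩
    refine Runs.mono (Runs.forLoop (N := N) (fun j s' => Frame L s s' ∧
      s'.reg L = ∑ j ∈ Finset.range j, f j ∧ s'.reg (L + 1) = j) hpos hNB ?_ ?_ ?_) le_rfl
      (fun s' h => ⟨h.1, h.2.1⟩)
    · exact ⟨hF₁.setReg (by omega), by simp [hs₁], by simp⟩
    · rintro j - s' ⟨hF, -, hj⟩
      exact ⟨hj, (hF.1 m hm).trans hN⟩
    · rintro j hj s' ⟨hF, hsum, hsj⟩
      refine Runs.seq (hp j hj s' hF hsj) ?_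
      rintro s'' ⟨hF'', hv⟩
      have e1 : s''.reg L = ∑ j ∈ Finset.range j, f j := (hF''.1 L (by omega)).trans hsum
      have e2 : s''.reg (L + 1) = j := (hF''.1 (L + 1) (by omega)).trans hsj
      -- Partial sums are bounded by the full sum, so they cannot overflow.
      have hle : ∑ i ∈ Finset.range (j + 1), f i ≤ ∑ i ∈ Finset.range N, f i :=
        Finset.sum_le_sum_of_subset (Finset.range_mono (by omega))
      rw [Finset.sum_range_succ] at hle
      refine Runs.assign ?_ ⟨?_, ?_, ?_, ?_⟩
      · simp only [Expr.Fits, Expr.eval, e1, hv]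
        omega
      · simp [e2]
      · exact ((hF.trans hF'' (by omega)).setReg le_rfl).setReg (by omega)
      · simp [Expr.eval, e1, hv, Finset.sum_range_succ]
      · simp
  refine Runs.mono (Runs.seq h0 h1) ?_ fun _ h => h
  have : N * (T + 20) = N * ((T + 4) + 14) + N * 2 := by ring
  omega

/-! ### The selection of the kernel -/

/-- Address of the entry in row `u` and column `w` of matrix `i`; the size is in register `0`. -/
def addrExpr (i u w : ℕ) : Expr :=
  .add (.mul (.add (.mul (.reg i) (.reg 0)) (.reg u)) (.reg 0)) (.reg w)

/-- Entry of the closed neighborhood matrix. -/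
def closedExpr (i u w : ℕ) : Expr := .add (.load 0 (addrExpr i u w)) (.eq (.reg u) (.reg w))

/-- The number of places in which the closed neighborhoods of `u` and `v` differ. -/
def distProg (L u v : ℕ) : Prog :=
  sumLoop L 1 (sumLoop (L + 2) 0 (.assign (L + 4) (.sub (.const 1)
    (.eq (closedExpr (L + 1) u (L + 3)) (closedExpr (L + 1) v (L + 3))))))

/-- The number of smaller twins of `v`. -/
def rankProg (L v : ℕ) : Prog :=
  sumLoop L 0 (.seq (distProg (L + 2) (L + 1) v)
    (.assign (L + 2) (.mul (.lt (.reg (L + 1)) (.reg v)) (.eq (.reg (L + 2)) (.const 0)))))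

/-- A number that is `0` if and only if all neighbors of `v` are twins of `v`. -/
def outProg (L v : ℕ) : Prog :=
  sumLoop L 0 (.seq (sumLoop (L + 2) 1 (.assign (L + 4) (.load 0 (addrExpr (L + 3) v (L + 1)))))
    (.seq (distProg (L + 3) (L + 1) v) (.assign (L + 2) (.mul (.reg (L + 2)) (.reg (L + 3))))))

/-- Whether `v` belongs to the kernel. -/
def keepProg (L v : ℕ) : Prog :=
  .seq (rankProg L v) (.seq (outProg (L + 1) v) (.assign L
    (.mul (.lt (.reg L) (.add (.add (.reg 2) (.reg 3)) (.const 2)))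
      (.lt (.const 0) (.reg (L + 1))))))

section Values

variable (n ℓ : ℕ) (A : ℕ → ℕ)

/-- Entry of the closed neighborhood matrix. -/
def closedVal (i u w : ℕ) : ℕ := A ((i * n + u) * n + w) + if u = w then 1 else 0

/-- The number of places in which the closed neighborhoods of `u` and `v` differ. -/
def distVal (u v : ℕ) : ℕ :=
  ∑ i ∈ Finset.range ℓ, ∑ w ∈ Finset.range n,
    (1 - if closedVal n A i u w = closedVal n A i v w then 1 else 0)

/-- The number of smaller twins of `v`. -/
def rankVal (v : ℕ) : ℕ :=
  ∑ u ∈ Finset.range n, (if u < v then 1 else 0) * (if distVal n ℓ A u v = 0 then 1 else 0)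

/-- A number that is `0` if and only if all neighbors of `v` are twins of `v`. -/
def outVal (v : ℕ) : ℕ :=
  ∑ u ∈ Finset.range n, (∑ i ∈ Finset.range ℓ, A ((i * n + v) * n + u)) * distVal n ℓ A u v

/-- `1` if `v` belongs to the kernel and `0` otherwise. -/
def keepVal (τ v : ℕ) : ℕ :=
  (if rankVal n ℓ A v < τ then 1 else 0) * (if 0 < outVal n ℓ A v then 1 else 0)

/-- Registers `0` and `1` and array `0` hold `n`, `ℓ` and `A`. -/
def Holds (s : State) : Prop := s.reg 0 = n ∧ s.reg 1 = ℓ ∧ s.mem 0 = A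

variable {n ℓ A}

theorem Holds.frame {L : ℕ} {s s' : State} (h : Holds n ℓ A s) (hF : Frame L s s')
    (hL : 2 ≤ L) : Holds n ℓ A s' :=
  ⟨(hF.1 0 (by omega)).trans h.1, (hF.1 1 (by omega)).trans h.2.1,
    (congrFun hF.2 0).trans h.2.2⟩

theorem addr_lt {i u w : ℕ} (hi : i < ℓ) (hu : u < n) (hw : w < n) :
    (i * n + u) * n + w < ℓ * n * n := by
  have h1 : i * n + u < ℓ * n := by nlinarith
  nlinarith

theorem distVal_le (u v : ℕ) : distVal n ℓ A u v ≤ ℓ * n := by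
  refine (Finset.sum_le_card_nsmul _ _ n fun i _ => ?_).trans (by simp)
  exact (Finset.sum_le_card_nsmul _ _ 1 fun w _ => Nat.sub_le _ _).trans (by simp)

theorem rankVal_le (v : ℕ) : rankVal n ℓ A v ≤ n := by
  refine (Finset.sum_le_card_nsmul _ _ 1 fun u _ => ?_).trans (by simp)
  split_ifs <;> simp

theorem sum_entries_le {u v : ℕ} (hA : ∀ x, A x ≤ 1) :
    ∑ i ∈ Finset.range ℓ, A ((i * n + v) * n + u) ≤ ℓ :=
  (Finset.sum_le_card_nsmul _ _ 1 fun _ _ => hA _).trans (by simp)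

theorem outVal_le (hA : ∀ x, A x ≤ 1) (v : ℕ) : outVal n ℓ A v ≤ n * (ℓ * (ℓ * n)) := by
  refine (Finset.sum_le_card_nsmul _ _ (ℓ * (ℓ * n)) fun u _ => ?_).trans (by simp)
  exact Nat.mul_le_mul (sum_entries_le hA) (distVal_le _ _)

theorem fits_addrExpr {B i u w : ℕ} {s : State} (hs : Holds n ℓ A s) (hi : s.reg i < ℓ)
    (hu : s.reg u < n) (hw : s.reg w < n) (hB : ℓ * n * n < B) : (addrExpr i u w).Fits B s := by
  have h := addr_lt hi hu hw
  have h1 : s.reg i * n + s.reg u < ℓ * n := by nlinarith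
  have h2 : ℓ * n ≤ ℓ * n * n := Nat.le_mul_of_pos_right _ (by omega)
  have h3 : n ≤ ℓ * n := Nat.le_mul_of_pos_left _ (by omega)
  have h4 : ℓ ≤ ℓ * n := Nat.le_mul_of_pos_right _ (by omega)
  simp only [addrExpr, Expr.Fits, Expr.eval, hs.1]
  omega

theorem eval_addrExpr {i u w : ℕ} {s : State} (hs : Holds n ℓ A s) :
    (addrExpr i u w).eval s = (s.reg i * n + s.reg u) * n + s.reg w := by
  simp only [addrExpr, Expr.eval, hs.1]

theorem fits_closedExpr {B i u w : ℕ} {s : State} (hs : Holds n ℓ A s) (hA : ∀ x, A x ≤ 1)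
    (hi : s.reg i < ℓ) (hu : s.reg u < n) (hw : s.reg w < n) (hB : ℓ * n * n + 2 < B) :
    (closedExpr i u w).Fits B s := by
  have h := fits_addrExpr hs hi hu hw (B := B) (by omega)
  have h2 : n ≤ ℓ * n := Nat.le_mul_of_pos_left _ (by omega)
  have h3 : ℓ * n ≤ ℓ * n * n := Nat.le_mul_of_pos_right _ (by omega)
  have hA' := hA ((addrExpr i u w).eval s)
  refine ⟨⟨h, ?_⟩, ⟨?_, ?_, ?_⟩, ?_⟩
  · rw [hs.2.2]; omega
  · simp only [Expr.Fits]; omega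
  · simp only [Expr.Fits]; omega
  · omega
  · have h5 : ((Expr.reg u).eq (.reg w)).eval s ≤ 1 := by
      unfold Expr.eval; split_ifs <;> omega
    have h6 : (Expr.load 0 (addrExpr i u w)).eval s ≤ 1 := by
      simpa only [Expr.eval, hs.2.2] using hA'
    omega

theorem eval_closedExpr {i u w : ℕ} {s : State} (hs : Holds n ℓ A s) :
    (closedExpr i u w).eval s = closedVal n A (s.reg i) (s.reg u) (s.reg w) := by
  simp only [closedExpr, Expr.eval, eval_addrExpr hs, hs.2.2, closedVal]
  rfl

theorem computes_distProg {B L u v : ℕ} {s : State} (hs : Holds n ℓ A s) (hA : ∀ x, A x ≤ 1)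
    (hℓ : 0 < ℓ) (hL : 2 ≤ L) (huL : u < L) (hvL : v < L) (hu : s.reg u < n) (hv : s.reg v < n)
    (hB : ℓ * n * n + 3 < B) :
    Computes B (72 * (ℓ * n)) L (distProg L u v) s (distVal n ℓ A (s.reg u) (s.reg v)) := by
  have h2 : n ≤ ℓ * n := Nat.le_mul_of_pos_left _ (by omega)
  have h3 : ℓ * n ≤ ℓ * n * n := Nat.le_mul_of_pos_right _ (by omega)
  have h4 : ℓ ≤ ℓ * n := Nat.le_mul_of_pos_right _ (by omega)
  have hd : distVal n ℓ A (s.reg u) (s.reg v) < B := by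
    have := distVal_le (n := n) (ℓ := ℓ) (A := A) (s.reg u) (s.reg v)
    omega
  -- The innermost assignment costs 32; each sum loop adds 20 per pass.
  refine Computes.mono (T := ℓ * (n * (32 + 20) + 20))
    (Computes.sumLoop (by omega) hs.2.1 hℓ (by omega) hd ?_) (by nlinarith)
  intro i hi s₁ hF₁ hi₁
  have hs₁ := hs.frame hF₁ hL
  refine Computes.sumLoop (by omega) hs₁.1 (by omega) (by omega) ?_ ?_
  · refine lt_of_le_of_lt (Finset.sum_le_card_nsmul _ _ 1 fun w _ => Nat.sub_le _ _) ?_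
    simp only [Finset.card_range, smul_eq_mul]
    omega
  intro w hw s₂ hF₂ hw₂
  have hs₂ := hs₁.frame hF₂ (by omega)
  have e1 : s₂.reg (L + 1) = i := (hF₂.1 _ (by omega)).trans hi₁
  have e2 : s₂.reg (L + 3) = w := hw₂
  have e3 : s₂.reg u = s.reg u := (hF₂.1 _ (by omega)).trans (hF₁.1 _ (by omega))
  have e4 : s₂.reg v = s.reg v := (hF₂.1 _ (by omega)).trans (hF₁.1 _ (by omega))
  refine Computes.assign ⟨?_, ?_, ?_, ?_⟩ ?_
  · simp only [Expr.Fits]; omega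
  · exact fits_closedExpr hs₂ hA (by omega) (by omega) (by omega) (by omega)
  · exact fits_closedExpr hs₂ hA (by omega) (by omega) (by omega) (by omega)
  · omega
  · simp only [Expr.eval, eval_closedExpr hs₂, e1, e2, e3, e4]

theorem computes_rankProg {B L v : ℕ} {s : State} (hs : Holds n ℓ A s) (hA : ∀ x, A x ≤ 1)
    (hℓ : 0 < ℓ) (hL : 2 ≤ L) (hvL : v < L) (hv : s.reg v < n) (hB : ℓ * n * n + 3 < B) :
    Computes B (100 * (ℓ * n * n)) L (rankProg L v) s (rankVal n ℓ A (s.reg v)) := by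
  have h2 : n ≤ ℓ * n := Nat.le_mul_of_pos_left _ (by omega)
  have h3 : ℓ * n ≤ ℓ * n * n := Nat.le_mul_of_pos_right _ (by omega)
  have hr : rankVal n ℓ A (s.reg v) < B := by
    have := rankVal_le (n := n) (ℓ := ℓ) (A := A) (s.reg v)
    omega
  refine Computes.mono (T := n * ((72 * (ℓ * n) + 8) + 20))
    (Computes.sumLoop (by omega) hs.1 (by omega) (by omega) hr ?_) (by nlinarith)
  intro u hu s₁ hF₁ hu₁
  have hs₁ := hs.frame hF₁ hL
  have hv₁ : s₁.reg v = s.reg v := hF₁.1 _ hvL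
  refine Computes.bind le_rfl (computes_distProg hs₁ hA hℓ (by omega) (by omega) (by omega)
    (by omega) (by omega) hB) ?_
  intro s₂ hF₂ hd
  have e1 : s₂.reg (L + 1) = u := (hF₂.1 _ (by omega)).trans hu₁
  have e2 : s₂.reg v = s.reg v := (hF₂.1 _ (by omega)).trans hv₁
  rw [hu₁, hv₁] at hd
  have := distVal_le (n := n) (ℓ := ℓ) (A := A) u (s.reg v)
  refine Computes.assign ?_ ?_
  · simp only [Expr.Fits, Expr.eval, e1, e2, hd]
    split_ifs <;> omega
  · simp only [Expr.eval, e1, e2, hd]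

theorem computes_outProg {B L v : ℕ} {s : State} (hs : Holds n ℓ A s) (hA : ∀ x, A x ≤ 1)
    (hℓ : 0 < ℓ) (hL : 2 ≤ L) (hvL : v < L) (hv : s.reg v < n) (hB : ℓ * n * n + 3 < B)
    (hB' : n * (ℓ * (ℓ * n)) < B) :
    Computes B (127 * (ℓ * n * n)) L (outProg L v) s (outVal n ℓ A (s.reg v)) := by
  have h2 : n ≤ ℓ * n := Nat.le_mul_of_pos_left _ (by omega)
  have h3 : ℓ * n ≤ ℓ * n * n := Nat.le_mul_of_pos_right _ (by omega)
  have h4 : ℓ ≤ ℓ * n := Nat.le_mul_of_pos_right _ (by omega)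
  have h5 : ℓ * (ℓ * n) ≤ n * (ℓ * (ℓ * n)) := Nat.le_mul_of_pos_left _ (by omega)
  refine Computes.mono (T := n * ((ℓ * (11 + 20) + (72 * (ℓ * n) + 4)) + 20))
    (Computes.sumLoop (by omega) hs.1 (by omega) (by omega) ((outVal_le hA _).trans_lt hB') ?_)
    (by nlinarith)
  intro u hu s₁ hF₁ hu₁
  have hs₁ := hs.frame hF₁ hL
  have hv₁ : s₁.reg v = s.reg v := hF₁.1 _ hvL
  have hsum := sum_entries_le (n := n) (ℓ := ℓ) (u := u) (v := s.reg v) hA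
  have hdist := distVal_le (n := n) (ℓ := ℓ) (A := A) u (s.reg v)
  refine Computes.bind le_rfl (Computes.sumLoop
    (f := fun i => A ((i * n + s.reg v) * n + u)) (by omega) hs₁.2.1 hℓ (by omega)
      (by omega) ?_) ?_
  · intro i hi s₂ hF₂ hi₂
    have hs₂ := hs₁.frame hF₂ (by omega)
    have e1 : s₂.reg (L + 1) = u := (hF₂.1 _ (by omega)).trans hu₁
    have e2 : s₂.reg v = s.reg v := (hF₂.1 _ (by omega)).trans hv₁
    have e3 : s₂.reg (L + 3) = i := hi₂
    refine Computes.assign ⟨?_, ?_⟩ ?_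
    · exact fits_addrExpr hs₂ (by omega) (by omega) (by omega) (by omega)
    · have := hA ((addrExpr (L + 3) v (L + 1)).eval s₂)
      rw [hs₂.2.2]; omega
    · simp only [Expr.eval, eval_addrExpr hs₂, hs₂.2.2, e1, e2, e3]
  · intro s₂ hF₂ hd
    have hs₂ := hs₁.frame hF₂ (by omega)
    have e1 : s₂.reg (L + 1) = u := (hF₂.1 _ (by omega)).trans hu₁
    have e2 : s₂.reg v = s.reg v := (hF₂.1 _ (by omega)).trans hv₁
    have hF₂' : s₂.reg (L + 2) = ∑ i ∈ Finset.range ℓ, A ((i * n + s.reg v) * n + u) := hd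
    refine Computes.bind (by omega) (computes_distProg hs₂ hA hℓ (by omega) (by omega) (by omega)
      (by omega) (by omega) hB) ?_
    intro s₃ hF₃ hd₃
    rw [e1, e2] at hd₃
    have e3 : s₃.reg (L + 2) = ∑ i ∈ Finset.range ℓ, A ((i * n + s.reg v) * n + u) :=
      (hF₃.1 _ (by omega)).trans hF₂'
    have hmul := Nat.mul_le_mul hsum hdist
    refine Computes.assign ?_ ?_
    · simp only [Expr.Fits, Expr.eval, e3, hd₃]
      omega
    · simp only [Expr.eval, e3, hd₃]

theorem computes_keepProg {B L v k d : ℕ} {s : State} (hs : Holds n ℓ A s) (hA : ∀ x, A x ≤ 1)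
    (hℓ : 0 < ℓ) (hL : 4 ≤ L) (hvL : v < L) (hv : s.reg v < n) (hk : s.reg 2 = k)
    (hd : s.reg 3 = d) (hB : ℓ * n * n + 3 < B) (hB' : n * (ℓ * (ℓ * n)) < B)
    (hB'' : k + d + 2 < B) :
    Computes B (240 * (ℓ * n * n)) L (keepProg L v) s (keepVal n ℓ A (k + d + 2) (s.reg v)) := by
  have h2 : n ≤ ℓ * n := Nat.le_mul_of_pos_left _ (by omega)
  have h3 : ℓ * n ≤ ℓ * n * n := Nat.le_mul_of_pos_right _ (by omega)
  refine Computes.mono (T := 100 * (ℓ * n * n) + (127 * (ℓ * n * n) + 12)) ?_ (by omega)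
  refine Computes.bind le_rfl (computes_rankProg hs hA hℓ (by omega) hvL hv hB) ?_
  intro s₁ hF₁ hr₁
  have hs₁ := hs.frame hF₁ (by omega)
  have hv₁ : s₁.reg v = s.reg v := hF₁.1 _ hvL
  refine Computes.bind (by omega) (computes_outProg hs₁ hA hℓ (by omega) (by omega) (by omega)
    hB hB') ?_
  intro s₂ hF₂ ho
  rw [hv₁] at ho
  have e1 : s₂.reg L = rankVal n ℓ A (s.reg v) := (hF₂.1 _ (by omega)).trans hr₁
  have e2 : s₂.reg 2 = k := ((hF₂.1 _ (by omega)).trans (hF₁.1 _ (by omega))).trans hk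
  have e3 : s₂.reg 3 = d := ((hF₂.1 _ (by omega)).trans (hF₁.1 _ (by omega))).trans hd
  have := rankVal_le (n := n) (ℓ := ℓ) (A := A) (s.reg v)
  have := outVal_le (n := n) (ℓ := ℓ) hA (s.reg v)
  refine Computes.assign ?_ ?_
  · simp only [Expr.Fits, Expr.eval, e1, e2, e3, ho]
    split_ifs <;> omega
  · simp only [Expr.eval, e1, e2, e3, ho, keepVal]

end Values

end WordRAM

/-! ### Listing the kernel vertices and compacting the matrices -/

namespace WordRAM

/-- List the vertices of the kernel in array `1` and count them in register `4`. -/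
def selectProg : Prog :=
  forLoop 5 0 (.seq (keepProg 6 5) (.seq (.store 1 (.reg 4) (.reg 5))
    (.assign 4 (.add (.reg 4) (.reg 6)))))

/-- Move the rows and columns of the kernel to the front. -/
def compactProg : Prog :=
  .seq (forLoop 5 1 (forLoop 6 4 (forLoop 7 4
    (.store 0 (.add (.mul (.add (.mul (.reg 5) (.reg 4)) (.reg 6)) (.reg 4)) (.reg 7))
      (.load 0 (.add (.mul (.add (.mul (.reg 5) (.reg 0)) (.load 1 (.reg 6))) (.reg 0))
        (.load 1 (.reg 7))))))))
    (.assign 0 (.reg 4))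

/-- Write the four parameters. -/
def paramProg (n ℓ k d : ℕ) : Prog :=
  .seq (.assign 0 (.const n)) (.seq (.assign 1 (.const ℓ)) (.seq (.assign 2 (.const k))
    (.assign 3 (.const d))))

/-- Write the entries of `l` to the addresses `x, x + 1, …` of array `0`. -/
def writeProg : ℕ → List ℕ → Prog
  | _, [] => .skip
  | x, v :: l => .seq (.store 0 (.const x) (.const v)) (writeProg (x + 1) l)

section Values

variable {n ℓ : ℕ} {A : ℕ → ℕ}

theorem keepVal_eq (τ v : ℕ) :
    keepVal n ℓ A τ v = if keepVal n ℓ A τ v = 1 then 1 else 0 := by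
  have : keepVal n ℓ A τ v ≤ 1 := by
    unfold keepVal; split_ifs <;> simp
  split_ifs <;> omega

/-- Every vertex is written to the next free slot, but the slot counter advances only for kept
vertices, so a rejected entry is overwritten or left beyond the final count. -/
theorem runs_selectProg {B k d : ℕ} {s : State} (hs : Holds n ℓ A s) (hA : ∀ x, A x ≤ 1)
    (hℓ : 0 < ℓ) (hn : 0 < n) (hk : s.reg 2 = k) (hd : s.reg 3 = d) (h4 : s.reg 4 = 0)
    (hB : ℓ * n * n + 3 < B) (hB' : n * (ℓ * (ℓ * n)) < B) (hB'' : k + d + 2 < B) :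
    Runs B selectProg s (261 * (ℓ * n ^ 3)) fun s' => Holds n ℓ A s' ∧ s'.reg 2 = k ∧
      s'.reg 3 = d ∧ s'.reg 4 = Nat.count (fun w => keepVal n ℓ A (k + d + 2) w = 1) n ∧
      ∀ w < n, keepVal n ℓ A (k + d + 2) w = 1 →
        s'.mem 1 (Nat.count (fun w => keepVal n ℓ A (k + d + 2) w = 1) w) = w := by
  set P : ℕ → Prop := fun w => keepVal n ℓ A (k + d + 2) w = 1 with hP
  have h2 : n ≤ ℓ * n := Nat.le_mul_of_pos_left _ (by omega)
  have h3 : ℓ * n ≤ ℓ * n * n := Nat.le_mul_of_pos_right _ (by omega)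
  have hT : n * ((240 * (ℓ * n * n) + (3 + 4)) + 14) ≤ 261 * (ℓ * n ^ 3) := by
    have : n * (21 * 1) ≤ n * (21 * (ℓ * n * n)) := by
      gcongr; omega
    calc _ = 240 * (ℓ * n ^ 3) + n * (21 * 1) := by ring
      _ ≤ 240 * (ℓ * n ^ 3) + n * (21 * (ℓ * n * n)) := by omega
      _ = _ := by ring
  refine Runs.mono (Runs.forLoop (N := n) (fun v s' => (Holds n ℓ A s' ∧ s'.reg 2 = k ∧
      s'.reg 3 = d ∧ s'.reg 4 = Nat.count P v ∧
      ∀ w < v, P w → s'.mem 1 (Nat.count P w) = w) ∧ s'.reg 5 = v) hn (by omega) ?_ ?_ ?_) hT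
      (fun s' h => h.1)
  · refine ⟨⟨⟨?_, ?_, ?_⟩, ?_, ?_, ?_, ?_⟩, ?_⟩
    · simpa using hs.1
    · simpa using hs.2.1
    · simpa using hs.2.2
    · simpa using hk
    · simpa using hd
    · simpa using h4
    · simp
    · simp
  · rintro j - s' ⟨h, h5⟩
    exact ⟨h5, h.1.1⟩
  · rintro v hv s₁ ⟨⟨hs₁, hk₁, hd₁, hc₁, hm₁⟩, hv₁⟩
    refine Runs.seq (computes_keepProg hs₁ hA hℓ (by omega) (by omega) (by omega) hk₁ hd₁
      hB hB' hB'') ?_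
    rintro s₂ ⟨hF₂, hkeep⟩
    have hs₂ := hs₁.frame hF₂ (by omega)
    rw [hv₁] at hkeep
    have e2 : s₂.reg 2 = k := (hF₂.1 _ (by omega)).trans hk₁
    have e3 : s₂.reg 3 = d := (hF₂.1 _ (by omega)).trans hd₁
    have e4 : s₂.reg 4 = Nat.count P v := (hF₂.1 _ (by omega)).trans hc₁
    have e5 : s₂.reg 5 = v := (hF₂.1 _ (by omega)).trans hv₁
    have em : s₂.mem 1 = s₁.mem 1 := congrFun hF₂.2 1
    have hcount : Nat.count P (v + 1) = Nat.count P v + s₂.reg 6 := by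
      rw [Nat.count_succ, hkeep]
      exact congrArg _ (keepVal_eq _ _).symm
    have hle : Nat.count P v + s₂.reg 6 ≤ n := by
      rw [← hcount]
      exact (Nat.count_monotone P hv).trans (Nat.count_le _)
    refine Runs.seq (T₁ := 3) (T₂ := 4) (Q₁ := fun s₃ => s₃ = s₂.setMem 1 (Nat.count P v) v) (Runs.store ?_ ?_ ?_) ?_
    · simp only [Expr.Fits]; omega
    · simp only [Expr.Fits]; omega
    · simp only [Expr.eval, e4, e5]
    · rintro s₃ rfl
      refine Runs.assign ?_ ⟨?_, ⟨⟨?_, ?_, ?_⟩, ?_, ?_, ?_, ?_⟩, ?_⟩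
      · simp only [Expr.Fits, Expr.eval, State.setMem_reg, e4]; omega
      · simpa using e5
      · simpa using hs₂.1
      · simpa using hs₂.2.1
      · refine Eq.trans ?_ hs₂.2.2
        ext x; simp
      · simpa using e2
      · simpa using e3
      · simp [Expr.eval, e4, hcount]
      · intro w hw hPw
        simp only [State.setReg_mem, State.setMem_mem, true_and, em]
        rcases Nat.lt_succ_iff_lt_or_eq.1 hw with hw | rfl
        · have : Nat.count P w < Nat.count P v := Nat.count_strict_mono hPw hw
          rw [if_neg this.ne]
          exact hm₁ w hw hPw
        · simp
      · simp

/-- The part of the matrices before address `x` has been moved. -/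
structure Compacted (n ℓ k d c : ℕ) (A pos : ℕ → ℕ) (x : ℕ) (s : State) : Prop where
  reg_zero : s.reg 0 = n
  reg_one : s.reg 1 = ℓ
  reg_two : s.reg 2 = k
  reg_three : s.reg 3 = d
  reg_four : s.reg 4 = c
  mem_one : ∀ a < c, s.mem 1 a = pos a
  mem_after : ∀ y, x ≤ y → s.mem 0 y = A y
  mem_before : ∀ i, ∀ a < c, ∀ b < c, (i * c + a) * c + b < x →
    s.mem 0 ((i * c + a) * c + b) = A ((i * n + pos a) * n + pos b)

theorem Compacted.setReg {n ℓ k d c : ℕ} {A pos : ℕ → ℕ} {x : ℕ} {s : State}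
    (h : Compacted n ℓ k d c A pos x s) {r v : ℕ} (hr : 5 ≤ r) :
    Compacted n ℓ k d c A pos x (s.setReg r v) := by
  obtain ⟨h0, h1, h2, h3, h4, h5, h6, h7⟩ := h
  have e0 : 0 ≠ r := by omega
  have e1 : 1 ≠ r := by omega
  have e2 : 2 ≠ r := by omega
  have e3 : 3 ≠ r := by omega
  have e4 : 4 ≠ r := by omega
  exact ⟨by simpa [e0] using h0, by simpa [e1] using h1, by simpa [e2] using h2,
    by simpa [e3] using h3, by simpa [e4] using h4, h5, h6, h7⟩

theorem eq_of_digits_eq {c i i' a a' : ℕ} (ha : a < c) (ha' : a' < c)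
    (h : i * c + a = i' * c + a') : i = i' ∧ a = a' := by
  have h1 : i = i' := by
    rcases lt_trichotomy i i' with h' | h' | h'
    · nlinarith
    · exact h'
    · nlinarith
  subst h1
  exact ⟨rfl, by omega⟩

theorem eq_of_addr_eq {c i i' a a' b b' : ℕ} (ha : a < c) (ha' : a' < c) (hb : b < c)
    (hb' : b' < c) (h : (i * c + a) * c + b = (i' * c + a') * c + b') :
    i = i' ∧ a = a' ∧ b = b' := by
  obtain ⟨h1, rfl⟩ := eq_of_digits_eq hb hb' h
  obtain ⟨rfl, rfl⟩ := eq_of_digits_eq ha ha' h1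
  exact ⟨rfl, rfl, rfl⟩

/-- The move is done in place. Targets are visited in increasing order and never exceed their
sources, so each source is still intact when it is read. -/
theorem runs_compactProg {B k d c : ℕ} {pos : ℕ → ℕ} {s : State}
    (hs : Compacted n ℓ k d c A pos 0 s) (hA : ∀ x, A x ≤ 1) (hℓ : 0 < ℓ) (hc : 0 < c)
    (hcn : c ≤ n) (hpos : ∀ a < c, a ≤ pos a ∧ pos a < n) (hB : ℓ * n * n + 3 < B) :
    Runs B compactProg s (66 * (ℓ * n ^ 3)) fun s' => s'.reg 0 = c ∧ s'.reg 1 = ℓ ∧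
      s'.reg 2 = k ∧ s'.reg 3 = d ∧ ∀ i < ℓ, ∀ a < c, ∀ b < c,
        s'.mem 0 ((i * c + a) * c + b) = A ((i * n + pos a) * n + pos b) := by
  have hn : 0 < n := by omega
  have h2 : n ≤ ℓ * n := Nat.le_mul_of_pos_left _ (by omega)
  have h3 : ℓ * n ≤ ℓ * n * n := Nat.le_mul_of_pos_right _ (by omega)
  have h4 : ℓ ≤ ℓ * n := Nat.le_mul_of_pos_right _ (by omega)
  have hT : ℓ * (c * (c * (22 + 14) + 14) + 14) + 2 ≤ 66 * (ℓ * n ^ 3) := by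
    have e1 : c * (c * (22 + 14) + 14) + 14 ≤ 64 * n ^ 3 := by
      have : c * (c * (22 + 14) + 14) + 14 ≤ n * (n * (22 + 14) + 14) + 14 := by gcongr
      have : n ^ 2 ≤ n ^ 3 := Nat.pow_le_pow_right hn (by omega)
      have : n ^ 1 ≤ n ^ 3 := Nat.pow_le_pow_right hn (by omega)
      have : 1 ≤ n ^ 3 := Nat.one_le_pow _ _ hn
      nlinarith
    have e2 : 1 ≤ ℓ * n ^ 3 := Nat.mul_pos hℓ (Nat.pow_pos hn)
    have e3 := Nat.mul_le_mul_left ℓ e1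
    have e4 : ℓ * (64 * n ^ 3) = 64 * (ℓ * n ^ 3) := by ring
    omega
  refine Runs.mono (Runs.seq (Runs.forLoop (N := ℓ) (fun i s' =>
    Compacted n ℓ k d c A pos (i * c * c) s' ∧ s'.reg 5 = i) hℓ (by omega) ?_ ?_ ?_)
      ?_) hT (fun _ h => h)
  · exact ⟨by simpa using hs.setReg le_rfl, by simp⟩
  · rintro i - s₁ ⟨h, h5⟩
    exact ⟨h5, h.reg_one⟩
  · rintro i hi s₁ ⟨hs₁, h5₁⟩
    refine Runs.mono (Runs.forLoop (N := c) (fun a s' =>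
      Compacted n ℓ k d c A pos ((i * c + a) * c) s' ∧ s'.reg 5 = i ∧ s'.reg 6 = a) hc (by omega)
      ?_ ?_ ?_) le_rfl ?_
    · exact ⟨by simpa using hs₁.setReg (by omega), by simpa using h5₁, by simp⟩
    · rintro a - s₂ ⟨h, -, h6⟩
      exact ⟨h6, h.reg_four⟩
    · rintro a ha s₂ ⟨hs₂, h5₂, h6₂⟩
      refine Runs.mono (Runs.forLoop (N := c) (fun b s' =>
        Compacted n ℓ k d c A pos ((i * c + a) * c + b) s' ∧ s'.reg 5 = i ∧ s'.reg 6 = a ∧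
          s'.reg 7 = b) hc (by omega) ?_ ?_ ?_) le_rfl ?_
      · exact ⟨by simpa using hs₂.setReg (by omega), by simpa using h5₂, by simpa using h6₂,
          by simp⟩
      · rintro b - s₃ ⟨h, -, -, h7⟩
        exact ⟨h7, h.reg_four⟩
      · rintro b hb s₃ ⟨hs₃, h5, h6, h7⟩
        obtain ⟨g0, g1, g2, g3, g4, gm, ga, gb⟩ := hs₃
        have hdest : (i * c + a) * c + b < ℓ * c * c := addr_lt hi ha hb
        have hsrc : (i * n + pos a) * n + pos b < ℓ * n * n :=
          addr_lt hi (hpos a ha).2 (hpos b hb).2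
        have hle : (i * c + a) * c + b ≤ (i * n + pos a) * n + pos b :=
          Nat.add_le_add (Nat.mul_le_mul (Nat.add_le_add (Nat.mul_le_mul_left i hcn)
            (hpos a ha).1) hcn) (hpos b hb).1
        have q1 : i * c + a ≤ (i * c + a) * c := Nat.le_mul_of_pos_right _ hc
        have q2 : i * n + pos a ≤ (i * n + pos a) * n := Nat.le_mul_of_pos_right _ hn
        have q3 := (hpos a ha).2
        have q4 := (hpos b hb).2
        have q5 := hA ((i * n + pos a) * n + pos b)
        have hval : s₃.mem 0 ((i * n + pos a) * n + pos b) =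
            A ((i * n + pos a) * n + pos b) := ga _ hle
        refine Runs.store ?_ ?_ ?_
        · simp only [Expr.Fits, Expr.eval, h5, h6, h7, g4]
          omega
        · simp only [Expr.Fits, Expr.eval, h5, h6, h7, g0, gm a ha, gm b hb, hval]
          omega
        · simp only [Expr.eval, h5, h6, h7, g0, g4, gm a ha, gm b hb, hval]
          refine ⟨by simpa using h7, Compacted.setReg ⟨by simpa using g0, by simpa using g1,
            by simpa using g2, by simpa using g3, by simpa using g4, ?_, ?_, ?_⟩ (by omega),
            by simpa using h5, by simpa using h6, by simp⟩
          · intro a' ha'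
            simpa using gm a' ha'
          · intro y hy
            have : y ≠ (i * c + a) * c + b := by omega
            simpa [this] using ga y (by omega)
          · intro i' a' ha' b' hb' hlt
            rw [State.setMem_mem]
            by_cases heq : (i' * c + a') * c + b' = (i * c + a) * c + b
            · obtain ⟨rfl, rfl, rfl⟩ := eq_of_addr_eq ha' ha hb' hb heq
              simp
            · rw [if_neg (fun h => heq h.2)]
              exact gb i' a' ha' b' hb' (by omega)
      · rintro s₃ ⟨h, h5, h6, h7⟩
        refine ⟨h6, ?_, by simpa using h5, by simp⟩
        have : (i * c + (a + 1)) * c = (i * c + a) * c + c := by ring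
        rw [this]
        exact h.setReg (by omega)
    · rintro s₂ ⟨h, h5, h6⟩
      refine ⟨h5, ?_, by simp⟩
      have : (i + 1) * c * c = (i * c + c) * c := by ring
      rw [this]
      exact h.setReg le_rfl
  · rintro s₁ ⟨h, -⟩
    refine Runs.assign ?_ ⟨?_, ?_, ?_, ?_, ?_⟩
    · simp only [Expr.Fits, h.reg_four]; omega
    · simp [Expr.eval, h.reg_four]
    · simpa using h.reg_one
    · simpa using h.reg_two
    · simpa using h.reg_three
    · intro i hi a ha b hb
      exact h.mem_before i a ha b hb (addr_lt hi ha hb)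

theorem runs_paramProg {B : ℕ} {n ℓ k d : ℕ} {s : State} (hn : n < B) (hℓ : ℓ < B) (hk : k < B)
    (hd : d < B) : Runs B (paramProg n ℓ k d) s 8 fun s' => s'.reg 0 = n ∧ s'.reg 1 = ℓ ∧
      s'.reg 2 = k ∧ s'.reg 3 = d ∧ s'.mem = s.mem :=
  ⟨_, 2 + (2 + (2 + 2)), .seq (.assign _ _ _ hn) (.seq (.assign _ _ _ hℓ)
    (.seq (.assign _ _ _ hk) (.assign _ _ _ hd))), by omega, by simp [Expr.eval]⟩

theorem runs_writeProg {B : ℕ} (l : List ℕ) : ∀ (x : ℕ) (s : State), x + l.length < B →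
    (∀ v ∈ l, v < B) → Runs B (writeProg x l) s (3 * l.length + 1) fun s' => s'.reg = s.reg ∧
      (∀ y < x, s'.mem 0 y = s.mem 0 y) ∧ ∀ y (h : y < l.length), s'.mem 0 (x + y) = l[y] := by
  induction l with
  | nil => exact fun x s _ _ => ⟨s, 1, .skip s, by simp, by simp⟩
  | cons v l ih =>
    intro x s hx hl
    simp only [List.length_cons] at hx ⊢
    obtain ⟨s', t, he, ht, hr, h1, h2⟩ := ih (x + 1) (s.setMem 0 x v) (by omega)
      (fun w hw => hl w (by simp [hw]))
    refine ⟨s', 3 + t, .seq (.store s 0 (.const x) (.const v) ?_ ?_) he, by omega, hr, ?_, ?_⟩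
    · simp only [Expr.Fits]; omega
    · exact hl v (by simp)
    · intro y hy
      have : y ≠ x := by omega
      simpa [this] using h1 y (by omega)
    · rintro (_ | y) hy
      · simpa using h1 x (by omega)
      · simpa [Nat.add_assoc, Nat.add_comm 1] using h2 y (by omega)

end Values

end WordRAM

/-! ### Combinatorial meaning of the computed numbers -/

namespace ClusterEditing

open WordRAM

section Bridge

variable {ℓ n : ℕ} {G : Fin ℓ → SimpleGraph (Fin n)} {A : ℕ → ℕ}

open Classical in
/-- `A` holds the adjacency matrices of the layers `G`. -/
def IsMatrixOf (A : ℕ → ℕ) (G : Fin ℓ → SimpleGraph (Fin n)) : Prop :=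
  ∀ (i : Fin ℓ) (u v : Fin n), A ((i * n + u) * n + v) = if (G i).Adj u v then 1 else 0

open Classical in
theorem IsMatrixOf.closedVal_eq (hA : IsMatrixOf A G) (i : Fin ℓ) (u v : Fin n) :
    closedVal n A i u v = if ClosedAdj (G i) u v then 1 else 0 := by
  unfold closedVal
  rw [hA i u v]
  by_cases h : u = v
  · subst h; simp [ClosedAdj]
  · simp [ClosedAdj, h, Fin.val_inj]

theorem IsMatrixOf.distVal_eq_zero_iff (hA : IsMatrixOf A G) (u v : Fin n) :
    distVal n ℓ A u v = 0 ↔ Twin G u v := by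
  classical
  unfold distVal Twin
  rw [Finset.sum_range, Finset.sum_eq_zero_iff]
  simp only [Finset.mem_univ, true_imp_iff]
  refine forall_congr' fun i => ?_
  rw [Finset.sum_range, Finset.sum_eq_zero_iff]
  simp only [Finset.mem_univ, true_imp_iff]
  refine forall_congr' fun x => ?_
  simp only [hA.closedVal_eq]
  by_cases h1 : ClosedAdj (G i) u x <;> by_cases h2 : ClosedAdj (G i) v x <;> simp [h1, h2]

theorem IsMatrixOf.rankVal_eq (hA : IsMatrixOf A G) (v : Fin n) :
    rankVal n ℓ A v = twinRank G v := by
  classical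
  unfold rankVal twinRank
  rw [Finset.sum_range, Finset.card_filter]
  refine Finset.sum_congr rfl fun u _ => ?_
  simp only [hA.distVal_eq_zero_iff, Fin.val_fin_lt]
  by_cases h1 : u < v <;> by_cases h2 : Twin G u v <;> simp [h1, h2]

theorem IsMatrixOf.outVal_eq_zero_iff (hA : IsMatrixOf A G) (v : Fin n) :
    outVal n ℓ A v = 0 ↔ IsIsolated G v := by
  classical
  unfold outVal IsIsolated
  rw [Finset.sum_range, Finset.sum_eq_zero_iff]
  simp only [Finset.mem_univ, true_imp_iff, Nat.mul_eq_zero, hA.distVal_eq_zero_iff]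
  rw [forall_comm]
  refine forall_congr' fun u => ?_
  rw [Finset.sum_range, Finset.sum_eq_zero_iff]
  simp only [Finset.mem_univ, true_imp_iff, hA _ _ _]
  constructor
  · rintro (h | h) i hi
    · simpa [hi] using h i
    · exact h.symm
  · intro h
    by_cases h' : ∃ i, (G i).Adj v u
    · obtain ⟨i, hi⟩ := h'
      exact Or.inr (h i hi).symm
    · push Not at h'
      exact Or.inl fun i => by simp [h' i]

theorem IsMatrixOf.keepVal_eq_one_iff (hA : IsMatrixOf A G) (τ : ℕ) (v : Fin n) :
    keepVal n ℓ A τ v = 1 ↔ v ∈ kernelVerts G τ := by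
  rw [mem_kernelVerts, ← hA.outVal_eq_zero_iff, ← hA.rankVal_eq]
  unfold keepVal
  by_cases h1 : rankVal n ℓ A v < τ <;> by_cases h2 : outVal n ℓ A v = 0 <;>
    simp [h1, h2, Nat.pos_iff_ne_zero]

/-- The vertices of the kernel in increasing order. -/
theorem exists_embedding_kernelVerts (hA : IsMatrixOf A G) (τ : ℕ) :
    ∃ (c : ℕ) (f : Fin c ↪ Fin n), c = Nat.count (fun w => keepVal n ℓ A τ w = 1) n ∧
      Finset.univ.map f = kernelVerts G τ ∧
      ∀ a, Nat.count (fun w => keepVal n ℓ A τ w = 1) (f a) = a ∧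
        keepVal n ℓ A τ (f a) = 1 := by
  set P : ℕ → Prop := fun w => keepVal n ℓ A τ w = 1 with hP
  have hlt : ∀ a : Fin (Nat.count P n), Nat.nth P a < n := fun a => Nat.nth_lt_of_lt_count a.2
  have hmem : ∀ a : Fin (Nat.count P n), P (Nat.nth P a) := fun a => Nat.nth_mem _
    fun hf => a.2.trans_le (Nat.count_le_card hf n)
  have hcount : ∀ a : Fin (Nat.count P n), Nat.count P (Nat.nth P a) = a := fun a =>
    Nat.count_nth fun hf => a.2.trans_le (Nat.count_le_card hf n)
  -- The embedding is `Nat.nth P`; its inverse `Nat.count P` is the slot used by `selectProg`.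
  refine ⟨_, ⟨fun a => ⟨Nat.nth P a, hlt a⟩, fun a b h => ?_⟩, rfl, ?_, fun a => ⟨hcount a, hmem a⟩⟩
  · rw [Fin.mk.injEq] at h
    have h' := congrArg (Nat.count P) h
    rw [hcount, hcount] at h'
    exact Fin.ext h'
  · ext v
    rw [← hA.keepVal_eq_one_iff, Finset.mem_map]
    constructor
    · rintro ⟨a, -, rfl⟩
      exact hmem a
    · intro hv
      refine ⟨⟨Nat.count P v, Nat.count_strict_mono hv v.2⟩, Finset.mem_univ _, Fin.ext ?_⟩
      exact Nat.nth_count (p := P) hv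

end Bridge

theorem isMatrixOf_initState (I : Instance) : IsMatrixOf ((initState I).mem 0) I.layer := by
  classical
  intro i u v
  simp only [initState, true_and]
  refine if_congr ⟨?_, fun h => ⟨i, u, v, rfl, h⟩⟩ rfl rfl
  rintro ⟨i', u', v', h, hadj⟩
  obtain ⟨h1, h2, h3⟩ := eq_of_addr_eq u.2 u'.2 v.2 v'.2 h
  rwa [Fin.ext h1, Fin.ext h2, Fin.ext h3]

theorem initState_mem_le (I : Instance) (x : ℕ) : (initState I).mem 0 x ≤ 1 := by
  simp only [initState]
  split_ifs <;> omega

/-! ### Trivial instances and the size estimate -/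

theorem solvable_empty {V κ : Type*} {ℓ : ℕ} {E : κ → Fin ℓ → Fin ℓ → Prop} {k d : ℕ}
    {G : Fin ℓ → SimpleGraph V} : Solvable E k d G ∅ :=
  ⟨fun _ => ⊥, fun _ => ∅, by simp, by simp [diffPairs], by simp, by simp⟩

/-- The instance without vertices and layers. -/
def emptyInstance : Instance := ⟨0, 0, 0, 0, fun i => i.elim0⟩

/-- A path with three vertices, and no modification allowed. -/
def pathInstance : Instance := ⟨3, 1, 0, 0, fun _ =>
  -- Adjacency is the parity of the matrix address, so the matrix reads 0, 1, 0, 1, … and the edges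
  -- are 0–1 and 1–2.
  { Adj := fun u v => (3 * u.val + v.val) % 2 = 1
    symm := ⟨fun u v h => by omega⟩
    loopless := ⟨fun u h => by omega⟩ }⟩

theorem size_le_self (x : ℕ) : x.size ≤ x := Nat.size_le.2 Nat.lt_two_pow_self

theorem not_hasConsistentClustering_pathInstance {κ : Type*}
    {E : κ → Fin pathInstance.ℓ → Fin pathInstance.ℓ → Prop} :
    ¬ HasConsistentClustering E pathInstance.k pathInstance.d pathInstance.layer := by
  rintro ⟨M, hM, hk, -⟩
  let i : Fin pathInstance.ℓ := ⟨0, Nat.one_pos⟩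
  have h0 : M i = ∅ := Finset.card_eq_zero.1 (Nat.le_zero.1 (hk i))
  have h := isClusterGraph_iff.1 (hM i).2
  rw [h0] at h
  have h' := h (0 : Fin 3) (1 : Fin 3) (2 : Fin 3)
  simp [edit_adj, pathInstance] at h'
  exact absurd (h' (Finset.notMem_empty _) (Finset.notMem_empty _)) (Finset.notMem_empty _)

/-- The parameters can be bounded by the size of the kernel. -/
theorem kernel_size_le {n' ℓ k d m : ℕ} (hℓ : 0 < ℓ) (hm : 0 < m) (hpos : 0 < n')
    (hn' : n' ≤ 2 * (k * ℓ) + d * m + (k + d + 2) * (2 * (k * ℓ) + d * m * ℓ)) :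
    (2 * n'.size + 2) + (2 * ℓ.size + 2) + (2 * k.size + 2) + (2 * d.size + 2) + ℓ * n' ^ 2
      + (k + d + ℓ) ≤ 400 * (ℓ ^ 3 * (k + d * m) ^ 4 + 1) := by
  set p := k + d * m with hp
  have hkp : k ≤ p := Nat.le_add_right _ _
  have hmp : d * m ≤ p := Nat.le_add_left _ _
  have hdp : d ≤ p := (Nat.le_mul_of_pos_right d hm).trans hmp
  -- For `p = 0` the bound `hn'` would force `n' = 0`. Without a vertex `ℓ` need not be bounded by
  -- the size, which is why an empty kernel is replaced by the empty instance.
  have hp1 : 1 ≤ p := by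
    by_contra h
    have h1 : k = 0 := by omega
    have h2 : d * m = 0 := by omega
    rw [h1, h2] at hn'
    simp at hn'
    omega
  -- The three summands contribute 2, 1 and 4 · 3 = 12.
  have hn15 : n' ≤ 15 * (ℓ * p ^ 2) := by
    have e1 : 2 * (k * ℓ) ≤ 2 * (p * ℓ) := by gcongr
    have e2 : d * m * ℓ ≤ p * ℓ := by gcongr
    have e3 : k + d + 2 ≤ 4 * p := by omega
    have e4 : p * ℓ ≤ ℓ * p ^ 2 := by
      calc p * ℓ = ℓ * p ^ 1 := by ring
        _ ≤ ℓ * p ^ 2 := Nat.mul_le_mul_left _ (Nat.pow_le_pow_right hp1 (by omega))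
    have e5 : d * m ≤ p * ℓ := hmp.trans (Nat.le_mul_of_pos_right _ hℓ)
    have e6 : (k + d + 2) * (2 * (k * ℓ) + d * m * ℓ) ≤ 4 * p * (3 * (p * ℓ)) :=
      Nat.mul_le_mul e3 (by omega)
    have e7 : 4 * p * (3 * (p * ℓ)) = 12 * (ℓ * p ^ 2) := by ring
    omega
  have s1 : ℓ * p ^ 2 ≤ ℓ ^ 3 * p ^ 4 :=
    Nat.mul_le_mul (Nat.le_self_pow (by omega) _) (Nat.pow_le_pow_right hp1 (by omega))
  have s2 : ℓ ≤ ℓ ^ 3 * p ^ 4 :=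
    (Nat.le_self_pow (by omega) _).trans (Nat.le_mul_of_pos_right _ (Nat.pow_pos hp1))
  have s3 : p ≤ ℓ ^ 3 * p ^ 4 :=
    (Nat.le_self_pow (by omega) _).trans (Nat.le_mul_of_pos_left _ (Nat.pow_pos hℓ))
  have s4 : ℓ * n' ^ 2 ≤ 225 * (ℓ ^ 3 * p ^ 4) := by
    calc ℓ * n' ^ 2 ≤ ℓ * (15 * (ℓ * p ^ 2)) ^ 2 := by gcongr
      _ = 225 * (ℓ ^ 3 * p ^ 4) := by ring
  have b1 := size_le_self n'
  have b2 := size_le_self ℓ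
  have b3 := size_le_self k
  have b4 := size_le_self d
  omega

end ClusterEditing

/-! ### The kernelization program and its correctness -/

namespace ClusterEditing

open WordRAM

/-- Output of the instance without vertices and layers. -/
def emptyProg : Prog := paramProg 0 0 0 0

/-- Output of the path with three vertices. -/
def pathProg : Prog := .seq (writeProg 0 [0, 1, 0, 1, 0, 1, 0, 1, 0]) (paramProg 3 1 0 0)

/-- The bound on the number of vertices of the kernel of a solvable instance, where `e` bounds the
number of marked vertices. -/
def boundExpr (e : Expr) : Expr :=
  .add (.add (.mul (.const 2) (.mul (.reg 2) (.reg 1))) e)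
    (.mul (.add (.add (.reg 2) (.reg 3)) (.const 2))
      (.add (.mul (.const 2) (.mul (.reg 2) (.reg 1))) (.mul e (.reg 1))))

/-- The kernelization. -/
def kernelProg (e : Expr) : Prog :=
  .ite (.mul (.reg 0) (.reg 1))
    (.seq selectProg
      (.ite (.reg 4) (.ite (.lt (boundExpr e) (.reg 4)) pathProg compactProg) emptyProg))
    emptyProg

/-- The output represents an instance that is equivalent to `I` and small. -/
def IsKernelState (Q : Instance → Prop) (size : (k d ℓ : ℕ) → ℕ) (C : ℕ) (I : Instance)
    (s : State) : Prop :=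
  ∃ J, Represents s J ∧ (Q J ↔ Q I) ∧
    J.bitLength + (J.k + J.d + J.ℓ) ≤ C * (size I.k I.d I.ℓ + 1)

theorem runs_emptyProg {Q : Instance → Prop} {size : (k d ℓ : ℕ) → ℕ} {I : Instance} {B : ℕ}
    {s : State} (hB : 0 < B) (h : Q I) (h' : Q emptyInstance) :
    Runs B emptyProg s 8 (IsKernelState Q size 400 I) := by
  refine Runs.mono (runs_paramProg hB hB hB hB) le_rfl ?_
  rintro s' ⟨h0, h1, h2, h3, -⟩
  refine ⟨emptyInstance, ⟨h0, h1, h2, h3, fun i => i.elim0⟩, iff_of_true h' h, ?_⟩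
  simp only [Instance.bitLength, emptyInstance, Nat.size_zero]
  omega

theorem runs_pathProg {Q : Instance → Prop} {size : (k d ℓ : ℕ) → ℕ} {I : Instance} {B : ℕ}
    {s : State} (hB : 9 < B) (h : ¬ Q I) (h' : ¬ Q pathInstance) :
    Runs B pathProg s 36 (IsKernelState Q size 400 I) := by
  classical
  refine Runs.seq (T₁ := 28) (T₂ := 8) (runs_writeProg _ 0 s (by simpa using hB) ?_) ?_
  · intro v hv
    simp only [List.mem_cons, List.not_mem_nil, or_false] at hv
    omega
  rintro s₁ ⟨-, -, hm⟩
  refine Runs.mono (runs_paramProg (by omega) (by omega) (by omega) (by omega)) le_rfl ?_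
  rintro s' ⟨h0, h1, h2, h3, hm'⟩
  refine ⟨pathInstance, ⟨h0, h1, h2, h3, ?_⟩, iff_of_false h' h, ?_⟩
  · simp only [zero_add] at hm
    have hentry : ∀ (i : Fin 1) (u v : Fin 3), s'.mem 0 ((i * 3 + u) * 3 + v) =
        if (3 * u.val + v.val) % 2 = 1 then 1 else 0 := by
      intro i u v
      obtain rfl : i = 0 := Subsingleton.elim _ _
      rw [hm']
      fin_cases u <;> fin_cases v <;> exact hm _ (by simp)
    exact fun i u v => (hentry i u v).trans (if_congr Iff.rfl rfl rfl)
  · have := size_le_self 3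
    have := size_le_self 1
    simp only [Instance.bitLength, pathInstance, Nat.size_zero]
    omega

/-- Kernelization for all problems given by a consistency pattern. -/
theorem hasKernel_of_pattern {κ : ℕ → Type} [∀ ℓ, Fintype (κ ℓ)]
    (E : ∀ ℓ, κ ℓ → Fin ℓ → Fin ℓ → Prop)
    (hE : ∀ ℓ i j, Relation.EqvGen (fun i j => ∃ c, E ℓ c i j) i j)
    (m : ℕ → ℕ) (hκ : ∀ ℓ, Fintype.card (κ ℓ) ≤ m ℓ)
    (hm : ∀ ℓ, 0 < ℓ → 0 < m ℓ ∧ m ℓ ≤ ℓ) (e : Expr) (he : ∀ s, e.eval s = s.reg 3 * m (s.reg 1))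
    (hfit : ∀ B s, s.reg 3 < B → s.reg 1 < B → s.reg 3 * m (s.reg 1) < B → e.Fits B s)
    (hcost : e.cost ≤ 3) {Q : Instance → Prop}
    (hQ : ∀ I, Q I ↔ HasConsistentClustering (E I.ℓ) I.k I.d I.layer) :
    HasKernel Q (fun k d ℓ => ℓ ^ 3 * (k + d * m ℓ) ^ 4) (fun n ℓ => ℓ * n ^ 3) := by
  classical
  refine ⟨kernelProg e, 8, 400, fun I => ?_⟩
  suffices hmain : Runs ((I.n + I.ℓ + I.k + I.d + 2) ^ 8) (kernelProg e) (initState I)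
      (400 * (I.ℓ * I.n ^ 3 + 1))
      (IsKernelState Q (fun k d ℓ => ℓ ^ 3 * (k + d * m ℓ) ^ 4) 400 I) by
    obtain ⟨s, t, hex, ht, J, h1, h2, h3⟩ := hmain
    exact ⟨J, s, t, hex, h1, h2, h3, ht⟩
  have hQempty : Q emptyInstance := by
    rw [hQ, hasConsistentClustering_iff]
    exact solvable_empty
  have hQpath : ¬ Q pathInstance := by
    rw [hQ]
    exact not_hasConsistentClustering_pathInstance
  obtain ⟨n, ℓ, k, d, G⟩ := I
  set I : Instance := ⟨n, ℓ, k, d, G⟩ with hI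
  have hQI : Q I ↔ Solvable (E ℓ) k d G (kernelVerts G (k + d + 2)) := by
    rw [solvable_kernelVerts_iff, ← hasConsistentClustering_iff]
    exact hQ I
  change Runs ((n + ℓ + k + d + 2) ^ 8) _ _ (400 * (ℓ * n ^ 3 + 1)) _
  set X := n + ℓ + k + d + 2 with hX
  have hX2 : 2 ≤ X := by omega
  have hdℓ : 0 < ℓ → d * m ℓ ≤ X * X := fun h =>
    Nat.mul_le_mul (by omega) ((hm ℓ h).2.trans (by omega))
  have p1 : 2 * X ≤ X * X := Nat.mul_le_mul_right _ hX2
  have p2 : 2 * (X * X) ≤ X * X * X := by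
    have := Nat.mul_le_mul_left (X * X) hX2
    omega
  have p3 : 2 * (X * X * X) ≤ X * X * X * X := by
    have := Nat.mul_le_mul_left (X * X * X) hX2
    omega
  -- All values that occur are at most a small multiple of `X ^ 4`; since `X ≥ 2`, the word bound `X
  -- ^ 8` leaves room for the constant.
  have p4 : 16 * (X * X * X * X) ≤ X ^ 8 := by
    calc 16 * (X * X * X * X) = 2 ^ 4 * (X * X * X * X) := by norm_num
      _ ≤ X ^ 4 * (X * X * X * X) := Nat.mul_le_mul_right _ (Nat.pow_le_pow_left hX2 4)
      _ = X ^ 8 := by ring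
  set B := X ^ 8 with hB
  have b1 : ℓ * n * n ≤ X * X * X :=
    Nat.mul_le_mul (Nat.mul_le_mul (by omega) (by omega)) (by omega)
  have b2 : n * (ℓ * (ℓ * n)) ≤ X * (X * (X * X)) :=
    Nat.mul_le_mul (by omega) (Nat.mul_le_mul (by omega) (Nat.mul_le_mul (by omega) (by omega)))
  have b2' : X * (X * (X * X)) = X * X * X * X := by ring
  have b3 : n * ℓ ≤ X * X := Nat.mul_le_mul (by omega) (by omega)
  have b4 : k * ℓ ≤ X * X := Nat.mul_le_mul (by omega) (by omega)
  set A := (initState I).mem 0 with hA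
  have hAmat : IsMatrixOf A G := isMatrixOf_initState I
  have hA1 : ∀ x, A x ≤ 1 := initState_mem_le I
  have hs : Holds n ℓ A (initState I) := ⟨by simp [initState, hI], by simp [initState, hI], rfl⟩
  -- The summands pay for the three tests (3, 1 and 29 steps, plus 1 each), the selection, and the
  -- output. The last bracket covers either compaction or the path.
  refine Runs.mono (T := 3 + 1 + (261 * (ℓ * n ^ 3) + (1 + 1 + (29 + 1 + (66 * (ℓ * n ^ 3) + 36)))))
    (Runs.ite ?_ (fun hc => ?_) (fun hc => ?_)) (by omega) fun _ h => h
  · simp only [Expr.Fits, Expr.eval, hs.1, hs.2.1]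
    omega
  swap
  · simp only [Expr.eval, hs.1, hs.2.1] at hc
    refine Runs.mono (runs_emptyProg (by omega) (hQI.2 ?_) hQempty) (by omega) fun _ h => h
    convert solvable_empty
    -- With a vertex but no layer, every vertex is vacuously isolated, so the kernel is empty.
    refine Finset.eq_empty_of_forall_notMem fun v hv => (mem_kernelVerts.1 hv).1 ?_
    have hℓ : ℓ = 0 := (Nat.mul_eq_zero.1 hc).resolve_left v.pos.ne'
    subst hℓ
    exact fun i => i.elim0
  simp only [Expr.eval, hs.1, hs.2.1] at hc
  have hn : 0 < n := Nat.pos_of_ne_zero fun h => hc (by simp [h])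
  have hℓ : 0 < ℓ := Nat.pos_of_ne_zero fun h => hc (by simp [h])
  refine Runs.seq (runs_selectProg (k := k) (d := d) hs hA1 hℓ hn (by simp [initState, hI])
    (by simp [initState, hI]) (by simp [initState]) (by omega) (by omega) (by omega)) ?_
  obtain ⟨c, f, hcdef, hf, hfP⟩ := exists_embedding_kernelVerts hAmat (k + d + 2)
  have hcard : (kernelVerts G (k + d + 2)).card = c := by
    rw [← hf, Finset.card_map, Finset.card_univ, Fintype.card_fin]
  have hcn : c ≤ n := hcdef.le.trans (Nat.count_le _)
  rintro s₁ ⟨hs₁, hk₁, hd₁, hc₁, hm₁⟩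
  rw [← hcdef] at hc₁
  refine Runs.ite (by simp only [Expr.Fits, hc₁]; omega) (fun h4 => ?_) (fun h4 => ?_)
  swap
  · simp only [Expr.eval, hc₁] at h4
    refine Runs.mono (runs_emptyProg (by omega) (hQI.2 ?_) hQempty) (by omega) fun _ h => h
    rw [h4, Finset.card_eq_zero] at hcard
    rw [hcard]
    exact solvable_empty
  simp only [Expr.eval, hc₁] at h4
  have hc0 : 0 < c := Nat.pos_of_ne_zero h4
  set D := d * m ℓ with hD
  have heval : e.eval s₁ = D := by rw [he, hd₁, hs₁.2.1]
  have hefit : e.Fits B s₁ := by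
    refine hfit B s₁ (by rw [hd₁]; omega) (by rw [hs₁.2.1]; omega) ?_
    rw [hd₁, hs₁.2.1]
    have := hdℓ hℓ
    omega
  set N := 2 * (k * ℓ) + D + (k + d + 2) * (2 * (k * ℓ) + D * ℓ) with hN
  have hNeval : (boundExpr e).eval s₁ = N := by
    simp only [boundExpr, Expr.eval, heval, hk₁, hd₁, hs₁.2.1, hN]
  refine Runs.mono (Runs.ite (T := 66 * (ℓ * n ^ 3) + 36) ?_ (fun h5 => ?_) (fun h5 => ?_)) ?_
    fun _ h => h
  · have b5 := hdℓ hℓ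
    have b6 : D * ℓ ≤ X * X * X := Nat.mul_le_mul b5 (by omega)
    have b7 : (k + d + 2) * (2 * (k * ℓ) + D * ℓ) ≤ X * (2 * (X * X) + X * X * X) :=
      Nat.mul_le_mul (by omega) (by omega)
    have b8 : X * (2 * (X * X) + X * X * X) = 2 * (X * X * X) + X * X * X * X := by ring
    simp only [boundExpr, Expr.Fits, Expr.eval, heval, hk₁, hd₁, hs₁.2.1, hc₁, hefit, true_and]
    omega
  · simp only [Expr.eval, hNeval, hc₁] at h5
    have hNc : N < c := by
      by_contra h
      rw [if_neg h] at h5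
      exact h5 rfl
    refine Runs.mono (runs_pathProg (by omega) (fun h => ?_) hQpath) (by omega) fun _ h => h
    -- A solution would bound the kernel by `N`, contradicting `N < c`.
    obtain ⟨H, D', hsol⟩ := hQI.1 h
    have hle := hsol.card_kernelVerts_le (by omega) (hE ℓ)
    have h6 : Fintype.card (κ ℓ) * d ≤ D := by
      rw [hD, mul_comm]
      exact Nat.mul_le_mul_left _ (hκ ℓ)
    have h7 := Nat.mul_le_mul_right ℓ h6
    have h8 : (k + d + 2) * (2 * (k * ℓ) + Fintype.card (κ ℓ) * d * ℓ) ≤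
        (k + d + 2) * (2 * (k * ℓ) + D * ℓ) := Nat.mul_le_mul_left _ (by omega)
    omega
  · simp only [Expr.eval, hNeval, hc₁] at h5
    have hNc : c ≤ N := by
      by_contra h
      rw [if_pos (not_le.1 h)] at h5
      exact one_ne_zero h5
    let pos : ℕ → ℕ := fun a => if h : a < c then f ⟨a, h⟩ else 0
    have hpos : ∀ a (h : a < c), pos a = f ⟨a, h⟩ := fun a h => dif_pos h
    refine Runs.mono (runs_compactProg (pos := pos) ⟨hs₁.1, hs₁.2.1, hk₁, hd₁, hc₁, ?_, ?_, ?_⟩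
      hA1 hℓ hc0 hcn ?_ (by omega)) (by omega) ?_
    · intro a ha
      obtain ⟨g1, g2⟩ := hfP ⟨a, ha⟩
      have := hm₁ _ (f ⟨a, ha⟩).2 g2
      rw [g1] at this
      rw [this, hpos a ha]
    · intro y _
      rw [hs₁.2.2]
    · intro i a _ b _ h
      exact absurd h (Nat.not_lt_zero _)
    · intro a ha
      rw [hpos a ha]
      refine ⟨?_, (f ⟨a, ha⟩).2⟩
      have := (hfP ⟨a, ha⟩).1
      exact this.symm.le.trans (Nat.count_le _)
    · rintro s' ⟨h0, h1, h2, h3, hmem⟩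
      refine ⟨⟨c, ℓ, k, d, fun i => (G i).comap f⟩, ⟨h0, h1, h2, h3, ?_⟩, ?_, ?_⟩
      · intro i u v
        rw [hmem i i.2 u u.2 v v.2, hpos u u.2, hpos v v.2]
        exact hAmat i (f u) (f v)
      · rw [hQI, hQ, ← hf]
        exact hasConsistentClustering_comap_iff f
      · exact kernel_size_le hℓ (hm ℓ hℓ).1 hc0 hNc
  · simp only [boundExpr, Expr.cost]
    omega

/-! ### The two problems as consistency patterns -/

theorem mlce_iff (I : Instance) :
    MLCE I ↔ HasConsistentClustering (fun (_ : Unit) _ _ => True) I.k I.d I.layer := by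
  refine exists_congr fun M => and_congr_right fun _ => and_congr_right fun _ => ⟨?_, ?_⟩
  · rintro ⟨D, hd, hD⟩
    exact ⟨fun _ => D, fun _ => hd, fun _ i j _ => hD i j⟩
  · rintro ⟨D, hd, hD⟩
    exact ⟨D (), hd (), fun i j => hD () i j trivial⟩

theorem tce_iff (I : Instance) :
    TCE I ↔ HasConsistentClustering
      (fun (c : Fin (I.ℓ - 1)) i j => i.val = c.val ∧ j.val = c.val + 1) I.k I.d I.layer := by
  refine exists_congr fun M => and_congr_right fun _ => and_congr_right fun _ =>
    exists_congr fun D => and_congr_right fun _ => ⟨?_, ?_⟩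
  · rintro hD c ⟨i, hi⟩ ⟨j, hj⟩ ⟨hic, hjc⟩
    simp only at hic hjc
    subst hic hjc
    exact hD c
  · exact fun hD c => hD c _ _ ⟨rfl, rfl⟩

/-- Every layer is linked to layer `0` by a chain of consecutive layers. -/
theorem eqvGen_consecutive (ℓ : ℕ) (i j : Fin ℓ) :
    Relation.EqvGen (fun i j : Fin ℓ => ∃ c : Fin (ℓ - 1), i.val = c.val ∧ j.val = c.val + 1)
      i j := by
  have h0 : ∀ (x : ℕ) (hx : x < ℓ), Relation.EqvGen
      (fun i j : Fin ℓ => ∃ c : Fin (ℓ - 1), i.val = c.val ∧ j.val = c.val + 1)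
      ⟨0, by omega⟩ ⟨x, hx⟩ := by
    intro x
    induction x with
    | zero => exact fun _ => .refl _
    | succ x ih =>
      exact fun hx => (ih (by omega)).trans _ _ _ (.rel _ _ ⟨⟨x, by omega⟩, rfl, rfl⟩)
  exact ((h0 i i.2).symm _ _).trans _ _ _ (h0 j j.2)

end ClusterEditing

theorem theorem4 :
    ClusterEditing.HasKernel ClusterEditing.MLCE
      (fun k d ℓ => ℓ ^ 3 * (k + d) ^ 4) (fun n ℓ => ℓ * n ^ 3) ∧
    ClusterEditing.HasKernel ClusterEditing.TCE
      (fun k d ℓ => ℓ ^ 3 * (k + d * ℓ) ^ 4) (fun n ℓ => ℓ * n ^ 3) := by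
  constructor
  · have h := ClusterEditing.hasKernel_of_pattern (κ := fun _ => Unit) (fun _ _ _ _ => True)
      (fun _ _ _ => .rel _ _ ⟨(), trivial⟩) (fun _ => 1) (by simp) (fun _ h => ⟨one_pos, h⟩)
      (.reg 3) (by simp [WordRAM.Expr.eval]) (fun _ _ h _ _ => h) (by simp [WordRAM.Expr.cost])
      ClusterEditing.mlce_iff
    simpa only [mul_one] using h
  · exact ClusterEditing.hasKernel_of_pattern (κ := fun ℓ => Fin (ℓ - 1))
      (fun ℓ c i j => i.val = c.val ∧ j.val = c.val + 1) ClusterEditing.eqvGen_consecutive id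
      (by simp) (fun _ h => ⟨h, le_rfl⟩) (.mul (.reg 3) (.reg 1)) (fun _ => rfl)
      (fun _ _ h h' h'' => ⟨h, h', h''⟩) (by simp [WordRAM.Expr.cost]) ClusterEditing.tce_iff
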